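/- Let $F:\mathbb{R}^{n+1}\to[0,\infty)$ be a Minkowski norm: $F$ is convex, $F(tx)=tF(x)$ for $t>0$, $F(x)>0$ for $x\neq 0$, $F\in C^\infty(\mathbb{R}^{n+1}\setminus\{0\})$, and $\mathrm{Hess}(\tfrac12F^2)$ is positive definite on $\mathbb{R}^{n+1}\setminus\{0\}$. Let $\mathcal{W}=\{x: F(x)=1\}$ be its Wulff shape, and put $$G(x)(\xi,\eta)=D^2(\tfrac12F^2)(x)[\xi,\eta],\qquad Q(x)(\xi,\eta,\zeta)=D^3(\tfrac12F^2)(x)[\xi,\eta,\zeta].$$ Let $g$ be the Riemannian metric on $\mathcal{W}$ given by $g_z=G(z)|_{T_z\mathcal{W}}$. Let $d\mu=F^0(\bar\nu)\,d\mathcal{H}^n$ on $\mathcal{W}$, where $\bar\nu$ is the Euclidean unit outer normal, $F^0(\xi)=\sup_{x\ne0}\langle x,\xi\rangle/F(x)$, and $\mathcal{H}^n$ is the $n$-dimensional Hausdorff measure. For a $C^2$ function $S$ on $\mathcal{W}$ let $S_i$ and $S_{ij}$ be the components, in a $g$-orthonormal basis $e_1,\dots,e_n$ of $T_z\mathcal{W}$,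 of its first and second covariant derivatives with respect to the Levi-Civita connection of $g$, and let $Q_{ijk}=Q(z)(e_i,e_j,e_k)$. Then for every $S\in C^2(\mathcal{W})$ (not only for anisotropic support functions of convex hypersurfaces), and for every standard coordinate vector $E^\alpha$ of $\mathbb{R}^{n+1}$, $\alpha=1,\dots,n+1$, the following integrand is $\mu$-integrable and $$\int_{\mathcal{W}} G(z)(z,E^\alpha)\,\det\Big(S_{ij}-\tfrac12\sum_{k=1}^nQ_{ijk}S_k+S\delta_{ij}\Big)\,d\mu(z)=0 .$$ -/

import Mathlib

namespace AnisoMinkowski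

open MeasureTheory Set Filter Topology
open scoped ContDiff

/-- The space `ℝ^{n+1}` with its Euclidean structure. -/
abbrev Space (n : ℕ) : Type := EuclideanSpace ℝ (Fin (n + 1))

variable {n : ℕ}

/-- `G(x)(ξ,η)`: the second derivative of `½F²` at `x`, evaluated on `ξ, η`. -/
noncomputable def metricG (F : Space n → ℝ) (x ξ η : Space n) : ℝ :=
  iteratedFDeriv ℝ 2 (fun y => (1 / 2 : ℝ) * F y ^ 2) x ![ξ, η]

/-- `Q(x)(ξ,η,ζ)`: the third derivative of `½F²` at `x`, evaluated on `ξ, η, ζ`. -/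
noncomputable def tensorQ (F : Space n → ℝ) (x ξ η ζ : Space n) : ℝ :=
  iteratedFDeriv ℝ 3 (fun y => (1 / 2 : ℝ) * F y ^ 2) x ![ξ, η, ζ]

/-- Minkowski norms. Homogeneity is with respect to positive factors, so that `F` need not
be even. -/
structure IsMinkowskiNorm (F : Space n → ℝ) : Prop where
  convex : ConvexOn ℝ univ F
  homogeneous : ∀ t : ℝ, 0 < t → ∀ x, F (t • x) = t * F x
  pos : ∀ x, x ≠ 0 → 0 < F x
  smooth : ContDiffOn ℝ ∞ F {0}ᶜ
  elliptic : ∀ x, x ≠ 0 → ∀ ξ, ξ ≠ 0 → 0 < metricG F x ξ ξ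

/-- The Wulff shape `{F = 1}`. -/
def wulff (F : Space n → ℝ) : Set (Space n) := {x | F x = 1}

/-- The dual norm `F⁰(ξ) = sup_{x ≠ 0} ⟨x, ξ⟩ / F(x)`. -/
noncomputable def dualNorm (F : Space n → ℝ) (ξ : Space n) : ℝ :=
  ⨆ x : {x : Space n // x ≠ 0}, inner ℝ (x : Space n) ξ / F x

/-- The Euclidean unit outer normal of the Wulff shape, as the boundary of `{F ≤ 1}`. -/
noncomputable def outerNormal (F : Space n → ℝ) (z : Space n) : Space n :=
  ‖gradient F z‖⁻¹ • gradient F z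

/-- The anisotropic measure `dμ = F⁰(ν̄) dℋⁿ` of the Wulff shape, as a measure on `ℝ^{n+1}`
carried by the Wulff shape. The Hausdorff measure has its Euclidean normalization. -/
noncomputable def anisoMeasure (F : Space n → ℝ) : Measure (Space n) :=
  ((Measure.euclideanHausdorffMeasure n).restrict (wulff F)).withDensity
    (fun z => ENNReal.ofReal (dualNorm F (outerNormal F z)))

/-- `S` restricted to the hypersurface `W` is a function of class `C²`: near each point of `W`
it is the restriction of a `C²` function of the ambient space. Values off `W` do not matter. -/
def IsC2OnHypersurface (W : Set (Space n)) (S : Space n → ℝ) : Prop :=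
  ∀ z ∈ W, ∃ T : Space n → ℝ, ContDiffAt ℝ 2 T z ∧ ∀ᶠ y in 𝓝[W] z, S y = T y

/-- The `i`-th partial derivative. -/
noncomputable def pderiv {V : Type*} [NormedAddCommGroup V] [NormedSpace ℝ V]
    (i : Fin n) (f : (Fin n → ℝ) → V) (u : Fin n → ℝ) : V :=
  fderiv ℝ f u (Pi.single i 1)

/-- The Gram matrix `g_ij = G(φ)(∂_iφ, ∂_jφ)` of the metric `g` in the local
parametrization `φ` of the Wulff shape. -/
noncomputable def gram (F : Space n → ℝ) (φ : (Fin n → ℝ) → Space n) (u : Fin n → ℝ) :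
    Matrix (Fin n) (Fin n) ℝ :=
  Matrix.of fun i j => metricG F (φ u) (pderiv i φ u) (pderiv j φ u)

/-- The Christoffel symbol `Γ_ij^k` of the Levi-Civita connection of `g` in the local
parametrization `φ`. -/
noncomputable def christoffel (F : Space n → ℝ) (φ : (Fin n → ℝ) → Space n)
    (i j k : Fin n) (u : Fin n → ℝ) : ℝ :=
  (1 / 2) * ∑ l, (gram F φ u)⁻¹ k l *
    (pderiv i (fun w => gram F φ w j l) u + pderiv j (fun w => gram F φ w i l) u
      - pderiv l (fun w => gram F φ w i j) u)

/-- The first covariant derivative `S_i` in the local parametrization `φ`. -/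
noncomputable def cov1 (φ : (Fin n → ℝ) → Space n) (S : Space n → ℝ) (i : Fin n)
    (u : Fin n → ℝ) : ℝ :=
  pderiv i (fun w => S (φ w)) u

/-- The second covariant derivative `S_ij = ∂_i∂_j S - Γ_ij^k ∂_k S` with respect to `g`
in the local parametrization `φ`. -/
noncomputable def cov2 (F : Space n → ℝ) (φ : (Fin n → ℝ) → Space n) (S : Space n → ℝ)
    (i j : Fin n) (u : Fin n → ℝ) : ℝ :=
  pderiv i (cov1 φ S j) u - ∑ k, christoffel F φ i j k u * cov1 φ S k u

/-- `φ` gives smooth local coordinates of the Wulff shape centred at `z`, whose coordinate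
vectors `e_i = ∂_iφ(0)` are an orthonormal basis of the tangent space at `z` with respect
to `g`. Nothing is asked of the coordinate vectors at other points. -/
structure IsOrthonormalCoords (F : Space n → ℝ) (z : Space n) (φ : (Fin n → ℝ) → Space n) :
    Prop where
  smooth : ContDiffAt ℝ ∞ φ 0
  center : φ 0 = z
  mem_wulff : ∀ᶠ u in 𝓝 0, φ u ∈ wulff F
  orthonormal : ∀ i j, metricG F z (pderiv i φ 0) (pderiv j φ 0) = if i = j then 1 else 0

/-- The matrix `S_ij - ½ Q_ijk S_k + S δ_ij` at the point `φ 0`, in the orthonormal basis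
`e_i = ∂_iφ(0)` of the tangent space. -/
noncomputable def uMatrix (F : Space n → ℝ) (φ : (Fin n → ℝ) → Space n) (S : Space n → ℝ) :
    Matrix (Fin n) (Fin n) ℝ :=
  Matrix.of fun i j =>
    cov2 F φ S i j 0
      - (1 / 2) * ∑ k, tensorQ F (φ 0) (pderiv i φ 0) (pderiv j φ 0) (pderiv k φ 0) * cov1 φ S k 0
      + S (φ 0) * (if i = j then 1 else 0)


theorem IsMinkowskiNorm.contDiffAt {F : Space n → ℝ} (hF : IsMinkowskiNorm F) {x : Space n}
    (hx : x ≠ 0) : ContDiffAt ℝ ∞ F x :=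
  (hF.smooth x hx).contDiffAt (isOpen_compl_singleton.mem_nhds hx)

theorem IsMinkowskiNorm.ne_zero {F : Space n → ℝ} (hF : IsMinkowskiNorm F) {z : Space n}
    (hz : z ∈ wulff F) : z ≠ 0 := by
  rintro rfl
  have h := hF.homogeneous 2 two_pos 0
  have h1 : F 0 = 1 := hz
  rw [smul_zero, h1] at h
  norm_num at h

theorem IsMinkowskiNorm.fderiv_self {F : Space n → ℝ} (hF : IsMinkowskiNorm F) {z : Space n}
    (hz : z ∈ wulff F) : fderiv ℝ F z z = 1 := by
  have hd : HasFDerivAt F (fderiv ℝ F z) ((1 : ℝ) • z) := by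
    rw [one_smul]
    exact ((hF.contDiffAt (hF.ne_zero hz)).differentiableAt (by simp)).hasFDerivAt
  have h1 : HasDerivAt (fun t : ℝ => F (t • z)) (fderiv ℝ F z z) 1 := by
    have := hd.comp_hasDerivAt (1 : ℝ) ((hasDerivAt_id (1 : ℝ)).smul_const z)
    simp only [one_smul] at this
    exact this
  have h2 : HasDerivAt (fun t : ℝ => F (t • z)) 1 1 := by
    refine (hasDerivAt_id (1 : ℝ)).congr_of_eventuallyEq ?_
    filter_upwards [lt_mem_nhds (zero_lt_one (α := ℝ))] with t ht
    have h3 : F z = 1 := hz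
    rw [hF.homogeneous t ht, h3, mul_one, id]
  exact h1.unique h2

theorem IsMinkowskiNorm.exists_orthonormal {F : Space n → ℝ} (hF : IsMinkowskiNorm F)
    {z : Space n} (hz : z ∈ wulff F) :
    ∃ b : Fin n → Space n, (∀ i, fderiv ℝ F z (b i) = 0) ∧
      ∀ i j, metricG F z (b i) (b j) = if i = j then 1 else 0 := by
  have h0 := hF.ne_zero hz
  set f : Space n → ℝ := fun y => (1 / 2 : ℝ) * F y ^ 2 with hf
  have hfc : ContDiffAt ℝ ∞ f z := contDiffAt_const.mul ((hF.contDiffAt h0).pow 2)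
  have hG : ∀ ξ η, metricG F z ξ η = fderiv ℝ (fderiv ℝ f) z ξ η := by
    intro ξ η
    simp [metricG, iteratedFDeriv_two_apply, hf]
  have hsymm : ∀ ξ η, fderiv ℝ (fderiv ℝ f) z ξ η = fderiv ℝ (fderiv ℝ f) z η ξ := by
    have : IsSymmSndFDerivAt ℝ f z := hfc.isSymmSndFDerivAt
      (by simpa using (show ((2 : ℕ∞) : WithTop ℕ∞) ≤ ((⊤ : ℕ∞) : WithTop ℕ∞) from WithTop.coe_le_coe.2 le_top))
    exact fun ξ η => this ξ η
  let T : Submodule ℝ (Space n) := LinearMap.ker (fderiv ℝ F z).toLinearMap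
  have hT : Module.finrank ℝ T = n := by
    have hr : Module.finrank ℝ (LinearMap.range (fderiv ℝ F z).toLinearMap) = 1 := by
      have : LinearMap.range (fderiv ℝ F z).toLinearMap = ⊤ := by
        rw [LinearMap.range_eq_top]
        intro c
        exact ⟨c • z, by simp [hF.fderiv_self hz]⟩
      rw [this]; simp
    have := LinearMap.finrank_range_add_finrank_ker (fderiv ℝ F z).toLinearMap
    rw [hr, finrank_euclideanSpace_fin] at this
    change 1 + Module.finrank ℝ T = n + 1 at this
    omega
  let B : LinearMap.BilinForm ℝ T := LinearMap.mk₂ ℝ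
    (fun ξ η => fderiv ℝ (fderiv ℝ f) z ξ η) (by intros; simp) (by intros; simp)
    (by intros; simp) (by intros; simp)
  have hB : ∀ ξ η : T, B ξ η = metricG F z ξ η := by
    intro ξ η; rw [hG]; rfl
  obtain ⟨v, hv⟩ := LinearMap.BilinForm.exists_orthogonal_basis (B := B)
    ⟨fun ξ η => hsymm (ξ : Space n) η⟩
  have hpos : ∀ i, 0 < B (v i) (v i) := by
    intro i
    rw [hB]
    refine hF.elliptic z h0 _ ?_
    intro h
    exact v.ne_zero i (Subtype.ext h)
  let e : Fin n ≃ Fin (Module.finrank ℝ T) := finCongr hT.symm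
  refine ⟨fun i => (((Real.sqrt (B (v (e i)) (v (e i))))⁻¹ • v (e i) : T) : Space n), ?_, ?_⟩
  · intro i
    exact LinearMap.mem_ker.1 (((Real.sqrt (B (v (e i)) (v (e i))))⁻¹ • v (e i) : T)).2
  · intro i j
    rw [← hB]
    simp only [map_smul, LinearMap.smul_apply, smul_eq_mul]
    by_cases hij : i = j
    · subst hij
      have := Real.mul_self_sqrt (hpos (e i)).le
      have h2 := Real.sqrt_pos.2 (hpos (e i))
      simp only [if_true]
      field_simp
      nlinarith
    · have hne : e i ≠ e j := fun h => hij (e.injective h)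
      have : B (v (e i)) (v (e j)) = 0 := hv hne
      simp [this, hij]

/-- Orthonormal local coordinates exist at every point of the Wulff shape. -/
theorem IsMinkowskiNorm.exists_isOrthonormalCoords {F : Space n → ℝ} (hF : IsMinkowskiNorm F)
    {z : Space n} (hz : z ∈ wulff F) : ∃ φ, IsOrthonormalCoords F z φ := by
  obtain ⟨b, hb0, hb⟩ := hF.exists_orthonormal hz
  have h0 := hF.ne_zero hz
  have hz1 : F z = 1 := hz
  let L : (Fin n → ℝ) →L[ℝ] Space n :=
    ∑ i, (ContinuousLinearMap.proj (R := ℝ) (φ := fun _ : Fin n => ℝ) i).smulRight (b i)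
  have hL : ∀ i, L (Pi.single i 1) = b i := by
    intro i
    simp [L, Pi.single_apply, ite_smul]
  let w : (Fin n → ℝ) → Space n := fun u => z + L u
  have hw0 : w 0 = z := by simp [w]
  have hwc : ContDiff ℝ ∞ w := contDiff_const.add L.contDiff
  have hwd : HasFDerivAt w L 0 := L.hasFDerivAt.const_add z
  have hFw : ContDiffAt ℝ ∞ F (w 0) := by rw [hw0]; exact hF.contDiffAt h0
  have hFwd : HasFDerivAt (fun u => F (w u)) ((fderiv ℝ F z).comp L) 0 := by
    have h1 : HasFDerivAt F (fderiv ℝ F z) (w 0) := by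
      rw [hw0]; exact ((hF.contDiffAt h0).differentiableAt (by simp)).hasFDerivAt
    exact h1.comp (0 : Fin n → ℝ) hwd
  have hne : F (w 0) ≠ 0 := by rw [hw0, hz1]; exact one_ne_zero
  let φ : (Fin n → ℝ) → Space n := fun u => (F (w u))⁻¹ • w u
  have hφd : ∀ i, pderiv i φ 0 = b i := by
    intro i
    have h1 := (((hasDerivAt_inv hne).comp_hasFDerivAt (0 : Fin n → ℝ) hFwd)).smul hwd
    have h2 : HasFDerivAt φ _ 0 := h1
    rw [pderiv, h2.fderiv]
    simp [hL, hb0, hw0, hz1]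
  refine ⟨φ, ?_, ?_, ?_, ?_⟩
  · exact ((hFw.comp (0 : Fin n → ℝ) hwc.contDiffAt).inv hne).smul hwc.contDiffAt
  · simp [φ, hw0, hz1]
  · have hev : ∀ᶠ u in 𝓝 (0 : Fin n → ℝ), w u ≠ 0 :=
      hwc.continuous.continuousAt.eventually_ne (by rw [hw0]; exact h0)
    filter_upwards [hev] with u hu
    have hp := hF.pos _ hu
    change F ((F (w u))⁻¹ • w u) = 1
    rw [hF.homogeneous _ (inv_pos.2 hp), inv_mul_cancel₀ hp.ne']
  · intro i j
    rw [hφd, hφd]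
    exact hb i j

end AnisoMinkowski

/-! Extend `S` from the Wulff shape W to a function s homogeneous of degree one (`homExt`), and let
X = G⁻¹ ds (`hessGrad`), which is homogeneous of degree zero. Differentiating G(X, ·) = ds, and
using that Q annihilates the position vector, one finds that DX(z) kills z, takes values in the
G-orthogonal complement of z, which is the tangent space, and acts there by the matrix of the
theorem (`uMatrix_eq`). The determinant is thus the Jacobian of X along W. When `S` is a support
function, X parametrizes the hypersurface and the claim is the closing condition for its normals.
Convexity plays no role, because the Jacobian determinant is a null Lagrangian: ∫ det DY = 0 for
every compactly supported C¹ map Y (`integral_det_fderiv_eq_zero`).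

To use this, put Y_a = η(F) X + a χ(F) E (`cutoffMap`), where η cuts off near 0 and infinity and χ
is a decreasing cutoff with derivative supported where η = 1. The derivative of Y_a is (η/F) DX plus
the rank one term dF ⊗ (η' X + a χ' E), so `det_fderiv_hessGrad` gives det DY_a = (η/F)ⁿ dF(η' X + a
χ' E) det(u), with DX, dF and the matrix u taken at the radial projection of the point. Subtracting
the case a = 1 from a = 0 removes the X term. What remains is w(F) dF(E) det(u) with w(r) = -χ'(r)
r⁻ⁿ, and its integral over the whole space is zero.

Finally, the density w(F) dx pushed to W along rays is exactly μ (`coneMeasure_eq`), and G(z)(z, E)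
= dF(z)E on W by Euler's relation. The identification of measures is local: in the chart that
projects the tangent hyperplane at z centrally onto W, the two measures differ near z by factors
arbitrarily close to one. Here F⁰(ν̄) = 1/|∇F|, by convexity of F. -/

open MeasureTheory Set Filter Topology
open scoped ContDiff

/-! ### Jacobian determinants as null Lagrangians -/

/-- The top coefficient of `t ↦ det (1 + t A)` as a combination of its values. -/
theorem exists_weights_det_eq_sum (m : ℕ) (hm : 0 < m) (v : Fin (m + 1) → ℝ)
    (hv : Function.Injective v) :
    ∃ W : Fin (m + 1) → ℝ, ∑ j, W j = 0 ∧ ∀ A : Matrix (Fin m) (Fin m) ℝ,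
      A.det = ∑ j, W j * (1 + v j • A).det := by
  have key : ∀ P : Polynomial ℝ, P.natDegree ≤ m → P.coeff m =
      ∑ j, (Lagrange.basis Finset.univ v j).coeff m * P.eval (v j) := by
    intro P hP
    have h := Lagrange.eq_interpolate (f := P) (s := Finset.univ) (v := v) hv.injOn (by
      rw [Finset.card_univ, Fintype.card_fin]
      exact (Polynomial.degree_le_natDegree).trans_lt (by exact_mod_cast Nat.lt_succ_of_le hP))
    conv_lhs => rw [h, Lagrange.interpolate_apply, Polynomial.finsetSum_coeff]
    simp [mul_comm]
  refine ⟨fun j => (Lagrange.basis Finset.univ v j).coeff m, ?_, fun A => ?_⟩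
  -- The constant polynomial 1 has zero coefficient in degree m because m > 0, so the weights sum to
  -- zero.
  · have := key 1 (by simp)
    simpa [Polynomial.coeff_one, hm.ne'] using this.symm
  · have hd := Polynomial.natDegree_det_X_add_C_le A 1
    have hc := Polynomial.coeff_det_X_add_C_card A 1
    rw [Fintype.card_fin] at hd hc
    rw [← hc, key _ hd]
    refine Finset.sum_congr rfl fun j _ => ?_
    congr 1
    rw [← Polynomial.coe_evalRingHom, RingHom.map_det]
    congr 1
    ext i k
    by_cases hik : i = k <;> simp [hik, add_comm, mul_comm (A _ _)]

section
variable {E : Type*} [NormedAddCommGroup E] [NormedSpace ℝ E] [FiniteDimensional ℝ E]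
  [MeasurableSpace E] [BorelSpace E] (μ : Measure E) [μ.IsAddHaarMeasure]

/-- A small compactly supported `C¹` perturbation of the identity preserves the volume of a
large ball. -/
theorem eventually_setIntegral_det_one_add_smul {Y : E → E} (hY : ContDiff ℝ 1 Y) {R : ℝ}
    (hR : ∀ x, x ∉ Metric.closedBall (0 : E) R → Y x = 0) :
    ∀ᶠ t in 𝓝 (0 : ℝ), ∫ x in Metric.closedBall (0 : E) R,
      (ContinuousLinearMap.id ℝ E + t • fderiv ℝ Y x).det ∂μ
        = μ.real (Metric.closedBall (0 : E) R) := by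
  set B := Metric.closedBall (0 : E) R with hB
  have hcs : HasCompactSupport Y :=
    HasCompactSupport.intro (isCompact_closedBall (0 : E) R) hR
  obtain ⟨K, hK⟩ := hY.lipschitzWith_of_hasCompactSupport hcs one_ne_zero
  have hbound : ∀ x, ‖fderiv ℝ Y x‖ ≤ K := fun x => norm_fderiv_le_of_lipschitz ℝ hK
  have hdet : ∀ᶠ A in 𝓝 (ContinuousLinearMap.id ℝ E), 0 < ContinuousLinearMap.det A := by
    have hc : Continuous (ContinuousLinearMap.det : (E →L[ℝ] E) → ℝ) :=
      ContinuousLinearMap.continuous_det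
    have h1 : (ContinuousLinearMap.id ℝ E).det = 1 := by
      simp [ContinuousLinearMap.det]
    exact hc.continuousAt.eventually (by rw [h1]; exact lt_mem_nhds zero_lt_one)
  obtain ⟨δ, hδ, hδ'⟩ := Metric.eventually_nhds_iff.1 hdet
  -- The bound δ keeps the Jacobian positive; the bound 1 makes t • Y a contraction, so that id + t
  -- • Y is bijective.
  have hsmall : ∀ᶠ t in 𝓝 (0 : ℝ), |t| * K < min δ 1 := by
    have : Tendsto (fun t : ℝ => |t| * K) (𝓝 0) (𝓝 (|0| * K)) :=
      (continuous_abs.mul continuous_const).tendsto 0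
    rw [abs_zero, zero_mul] at this
    exact this.eventually (gt_mem_nhds (lt_min hδ one_pos))
  filter_upwards [hsmall] with t ht
  have htδ := ht.trans_le (min_le_left _ _)
  have ht1 := ht.trans_le (min_le_right _ _)
  set g : E → E := fun x => x + t • Y x with hg
  have hinj : Function.Injective g := by
    intro x y hxy
    by_contra hne
    have h1 : x - y = t • (Y y - Y x) := by
      have : x + t • Y x = y + t • Y y := hxy
      rw [smul_sub, sub_eq_sub_iff_add_eq_add, this, add_comm]
    have h2 : ‖x - y‖ ≤ |t| * K * ‖x - y‖ := by
      conv_lhs => rw [h1, norm_smul, Real.norm_eq_abs]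
      rw [mul_assoc, norm_sub_rev x y]
      gcongr
      simpa [dist_eq_norm] using hK.dist_le_mul y x
    have h3 : 0 < ‖x - y‖ := norm_pos_iff.2 (sub_ne_zero.2 hne)
    nlinarith
  have happ : ApproximatesLinearOn g ((ContinuousLinearEquiv.refl ℝ E : E ≃L[ℝ] E) : E →L[ℝ] E) univ
      (‖t‖₊ * K) := by
    intro x _ y _
    have : g x - g y - ((ContinuousLinearEquiv.refl ℝ E : E ≃L[ℝ] E) : E →L[ℝ] E) (x - y)
        = t • (Y x - Y y) := by
      simp only [hg, ContinuousLinearEquiv.coe_refl, ContinuousLinearMap.coe_id', id]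
      module
    rw [this, norm_smul, NNReal.coe_mul, coe_nnnorm, mul_assoc]
    gcongr
    simpa [dist_eq_norm] using hK.dist_le_mul x y
  have hsurj : Function.Surjective g := by
    refine happ.surjective ?_
    rcases subsingleton_or_nontrivial E with h | h
    · exact Or.inl h
    · right
      have h1 : ‖((ContinuousLinearEquiv.refl ℝ E).symm : E →L[ℝ] E)‖₊ = 1 := by
        ext; simp
      rw [h1, inv_one, ← NNReal.coe_lt_coe]
      simpa using ht1
  -- A bijection that fixes every point outside B must map B onto itself.
  have himage : g '' B = B := by
    have hfix : ∀ x, x ∉ B → g x = x := fun x hx => by simp [hg, hR x hx]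
    apply Subset.antisymm
    · rintro _ ⟨x, hx, rfl⟩
      by_contra hgx
      exact hgx (by rwa [hinj (hfix _ hgx)])
    · intro y hy
      obtain ⟨x, rfl⟩ := hsurj y
      by_cases hx : x ∈ B
      · exact ⟨x, hx, rfl⟩
      · rw [hfix x hx] at hy; exact absurd hy hx
  have hderiv : ∀ x ∈ B, HasFDerivWithinAt g (ContinuousLinearMap.id ℝ E + t • fderiv ℝ Y x) B x :=
    fun x _ => ((hasFDerivAt_id x).add
      ((hY.differentiable one_ne_zero x).hasFDerivAt.const_smul t)).hasFDerivWithinAt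
  have hcv := integral_image_eq_integral_abs_det_fderiv_smul μ Metric.isClosed_closedBall.measurableSet
    hderiv hinj.injOn (fun _ => (1 : ℝ))
  rw [himage] at hcv
  have hpos : ∀ x, 0 < (ContinuousLinearMap.id ℝ E + t • fderiv ℝ Y x).det := by
    intro x
    apply hδ'
    rw [dist_eq_norm, add_sub_cancel_left, norm_smul, Real.norm_eq_abs]
    exact (mul_le_mul_of_nonneg_left (hbound x) (abs_nonneg t)).trans_lt htδ
  simp only [abs_of_pos (hpos _), smul_eq_mul, mul_one] at hcv
  rw [← hcv]
  simp

/-- The Jacobian determinant of a compactly supported `C¹` map has integral zero. -/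
theorem integral_det_fderiv_eq_zero [Nontrivial E] {Y : E → E} (hY : ContDiff ℝ 1 Y)
    (hc : HasCompactSupport Y) : ∫ x, (fderiv ℝ Y x).det ∂μ = 0 := by
  obtain ⟨R, hR0⟩ := hc.isCompact.isBounded.subset_closedBall (0 : E)
  have hR : ∀ x, x ∉ Metric.closedBall (0 : E) R → Y x = 0 := fun x hx =>
    image_eq_zero_of_notMem_tsupport fun h => hx (hR0 h)
  set m := Module.finrank ℝ E with hm
  have hm0 : 0 < m := Module.finrank_pos
  obtain ⟨δ, hδ, hδ'⟩ := Metric.eventually_nhds_iff.1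
    (eventually_setIntegral_det_one_add_smul μ hY hR)
  -- These are m + 1 distinct nodes; the shift by 2 keeps all of them strictly below δ. At each node
  -- the integral is the volume of the ball, and the weights sum to zero.
  let v : Fin (m + 1) → ℝ := fun j => δ / ((j : ℝ) + 2)
  have hv : Function.Injective v := by
    intro i j hij
    have hi : (0 : ℝ) < (i : ℝ) + 2 := by positivity
    have hj : (0 : ℝ) < (j : ℝ) + 2 := by positivity
    have : δ / ((i : ℝ) + 2) = δ / ((j : ℝ) + 2) := hij
    rw [div_eq_div_iff hi.ne' hj.ne'] at this
    have := mul_left_cancel₀ hδ.ne' this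
    have h3 : (i : ℝ) = j := by linarith
    exact Fin.ext (by exact_mod_cast h3)
  obtain ⟨W, hW0, hW⟩ := exists_weights_det_eq_sum m hm0 v hv
  let b := Module.finBasis ℝ E
  have hWE : ∀ A : E →L[ℝ] E, A.det = ∑ j, W j * (ContinuousLinearMap.id ℝ E + v j • A).det := by
    intro A
    have h := hW (LinearMap.toMatrix b b A.toLinearMap)
    rw [LinearMap.det_toMatrix] at h
    refine h.trans (Finset.sum_congr rfl fun j _ => ?_)
    congr 1
    change _ = LinearMap.det (ContinuousLinearMap.toLinearMap _)
    rw [← LinearMap.det_toMatrix b]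
    congr 1
    simp
  have hdetc : Continuous fun x => (fderiv ℝ Y x).det :=
    ContinuousLinearMap.continuous_det.comp (hY.continuous_fderiv one_ne_zero)
  have hB : ∫ x, (fderiv ℝ Y x).det ∂μ
      = ∫ x in Metric.closedBall (0 : E) R, (fderiv ℝ Y x).det ∂μ := by
    refine (setIntegral_eq_integral_of_forall_compl_eq_zero fun x hx => ?_).symm
    have : fderiv ℝ Y x = 0 := fderiv_of_notMem_tsupport ℝ fun h => hx (hR0 h)
    rw [this]
    change LinearMap.det (0 : E →ₗ[ℝ] E) = 0
    rw [LinearMap.det_zero, zero_pow hm0.ne']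
  rw [hB]
  rw [show (fun x => (fderiv ℝ Y x).det) = fun x => ∑ j, W j *
    (ContinuousLinearMap.id ℝ E + v j • fderiv ℝ Y x).det from funext fun x => hWE _]
  rw [integral_finsetSum]
  · simp_rw [integral_const_mul]
    have : ∀ j, ∫ x in Metric.closedBall (0 : E) R,
        (ContinuousLinearMap.id ℝ E + v j • fderiv ℝ Y x).det ∂μ
          = μ.real (Metric.closedBall (0 : E) R) := by
      intro j
      apply hδ'
      have hj : (0 : ℝ) < (j : ℝ) + 2 := by positivity
      rw [dist_zero_right, Real.norm_eq_abs, abs_of_pos (div_pos hδ hj), div_lt_iff₀ hj]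
      nlinarith [(Nat.cast_nonneg (j : ℕ) : (0 : ℝ) ≤ _)]
    simp_rw [this, ← Finset.sum_mul, hW0, zero_mul]
  · intro j _
    refine Integrable.const_mul ?_ _
    refine (Continuous.continuousOn ?_).integrableOn_compact (isCompact_closedBall _ _)
    have hf := hY.continuous_fderiv one_ne_zero
    exact ContinuousLinearMap.continuous_det.comp (by fun_prop)

end

/-! ### Bases orthonormal for a bilinear form, and a rank one determinant formula -/

section LinearAlgebra

variable {E : Type*} [NormedAddCommGroup E] [NormedSpace ℝ E] {n : ℕ}

/-- A family orthonormal for a bilinear form is linearly independent. -/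
theorem linearIndependent_of_bilin_orthonormal (B : E →L[ℝ] E →L[ℝ] ℝ) {ι : Type*} [Finite ι]
    [DecidableEq ι] {v : ι → E} (hB : ∀ i j, B (v i) (v j) = if i = j then 1 else 0) :
    LinearIndependent ℝ v := by
  cases nonempty_fintype ι
  rw [Fintype.linearIndependent_iff]
  intro c hc i
  have := congrArg (B (v i)) hc
  simpa [hB] using this

/-- The basis of a family orthonormal for a bilinear form. -/
noncomputable def basisOfBilinOrthonormal (B : E →L[ℝ] E →L[ℝ] ℝ) {v : Fin (n + 1) → E}
    (hB : ∀ i j, B (v i) (v j) = if i = j then 1 else 0) (hE : Module.finrank ℝ E = n + 1) :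
    Module.Basis (Fin (n + 1)) ℝ E :=
  basisOfLinearIndependentOfCardEqFinrank (linearIndependent_of_bilin_orthonormal B hB)
    (by rw [Fintype.card_fin, hE])

theorem sum_bilin_smul (B : E →L[ℝ] E →L[ℝ] ℝ) {v : Fin (n + 1) → E}
    (hB : ∀ i j, B (v i) (v j) = if i = j then 1 else 0) (hE : Module.finrank ℝ E = n + 1)
    (w : E) : ∑ i, B (v i) w • v i = w := by
  have hv : ⇑(basisOfBilinOrthonormal B hB hE) = v :=
    coe_basisOfLinearIndependentOfCardEqFinrank _ _
  conv_rhs => rw [← (basisOfBilinOrthonormal B hB hE).sum_repr w]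
  refine Finset.sum_congr rfl fun i _ => ?_
  rw [hv]
  congr 1
  conv_lhs => rw [← (basisOfBilinOrthonormal B hB hE).sum_repr w]
  simp [hv, hB]

/-- Determinant of a rank one perturbation of an operator that preserves an orthogonal
splitting and kills the first vector. -/
theorem det_smul_add_smulRight (B : E →L[ℝ] E →L[ℝ] ℝ) {v : Fin (n + 1) → E}
    (hB : ∀ i j, B (v i) (v j) = if i = j then 1 else 0) (hE : Module.finrank ℝ E = n + 1)
    (D : E →L[ℝ] E) (hD : D (v 0) = 0) (h0 : ∀ ξ, B (v 0) (D ξ) = 0) (a : ℝ) (y : E) :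
    (a • D + (B (v 0)).smulRight y).det
      = a ^ n * (B (v 0) y * (Matrix.of fun i j : Fin n => B (v i.succ) (D (v j.succ))).det) := by
  set b := basisOfBilinOrthonormal B hB hE with hb
  have hv : ⇑b = v := coe_basisOfLinearIndependentOfCardEqFinrank _ _
  have hrepr : ∀ w i, b.repr w i = B (v i) w := by
    intro w i
    conv_rhs => rw [← b.sum_repr w]
    simp [hv, hB]
  change LinearMap.det (a • D + (B (v 0)).smulRight y).toLinearMap = _
  rw [← LinearMap.det_toMatrix b, Matrix.det_succ_row_zero, Fin.sum_univ_succ]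
  have hM : ∀ i j, LinearMap.toMatrix b b (a • D + (B (v 0)).smulRight y).toLinearMap i j
      = a * B (v i) (D (v j)) + (if (0 : Fin (n + 1)) = j then 1 else 0) * B (v i) y := by
    intro i j
    rw [LinearMap.toMatrix_apply, hrepr, hv]
    by_cases hj : (0 : Fin (n + 1)) = j <;> simp [hB, hj]
  -- The range of D is orthogonal to v 0, and B (v 0) sees only the first basis vector. The zeroth
  -- row therefore has a single nonzero entry, and in the complementary minor the rank one term
  -- disappears.
  have hrow : ∀ j : Fin n, LinearMap.toMatrix b b (a • D + (B (v 0)).smulRight y).toLinearMap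
      0 j.succ = 0 := by
    intro j
    rw [hM, h0, if_neg (Fin.succ_ne_zero j).symm]
    ring
  rw [Finset.sum_eq_zero fun j _ => by rw [hrow]; ring, hM, hD]
  have hsub : (LinearMap.toMatrix b b (a • D + (B (v 0)).smulRight y).toLinearMap).submatrix
      Fin.succ (Fin.succAbove 0) = a • Matrix.of fun i j : Fin n => B (v i.succ) (D (v j.succ)) := by
    ext i j
    rw [Matrix.submatrix_apply, hM, Fin.zero_succAbove, if_neg (Fin.succ_ne_zero j).symm]
    simp
  rw [hsub, Matrix.det_smul, Fintype.card_fin]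
  simp
  ring

end LinearAlgebra

/-! ### Euler's relations -/

section Homogeneous

variable {E V : Type*} [NormedAddCommGroup E] [NormedSpace ℝ E] [NormedAddCommGroup V]
  [NormedSpace ℝ V]

/-- Differentiability is not needed: scaling by a nonzero constant, inside or outside, commutes with
`fderiv` even where `fderiv` takes its default value. -/
theorem fderiv_smul_of_forall_smul {g : E → V} {r c : ℝ} (hr : r ≠ 0)
    (h : ∀ x, g (r • x) = c • g x) (x : E) : fderiv ℝ g (r • x) = (r⁻¹ * c) • fderiv ℝ g x := by
  have h1 : fderiv ℝ (fun y => g (r • y)) x = r • fderiv ℝ g (r • x) := fderiv_comp_smul r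
  have h2 : fderiv ℝ (fun y => g (r • y)) x = c • fderiv ℝ g x := by
    rw [show (fun y => g (r • y)) = c • g from funext h, fderiv_const_smul_field]
    rfl
  rw [mul_smul, ← h2, h1, smul_smul, inv_mul_cancel₀ hr, one_smul]

theorem hasDerivAt_comp_smul_one {g : E → V} {x : E} (hg : DifferentiableAt ℝ g x) :
    HasDerivAt (fun t : ℝ => g (t • x)) (fderiv ℝ g x x) 1 := by
  have hd : HasFDerivAt g (fderiv ℝ g x) ((1 : ℝ) • x) := by
    rw [one_smul]; exact hg.hasFDerivAt
  have := hd.comp_hasDerivAt (1 : ℝ) ((hasDerivAt_id (1 : ℝ)).smul_const x)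
  simp only [one_smul] at this
  exact this

theorem fderiv_self_of_homogeneous_one {g : E → V} {x : E} (hg : DifferentiableAt ℝ g x)
    (h : ∀ r : ℝ, 0 < r → g (r • x) = r • g x) : fderiv ℝ g x x = g x := by
  refine (hasDerivAt_comp_smul_one hg).unique ?_
  have : HasDerivAt (fun t : ℝ => t • g x) ((1 : ℝ) • g x) 1 := (hasDerivAt_id (1 : ℝ)).smul_const _
  rw [one_smul] at this
  refine this.congr_of_eventuallyEq ?_
  filter_upwards [lt_mem_nhds (zero_lt_one (α := ℝ))] with t ht using h t ht

theorem fderiv_self_of_homogeneous_zero {g : E → V} {x : E} (hg : DifferentiableAt ℝ g x)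
    (h : ∀ r : ℝ, 0 < r → g (r • x) = g x) : fderiv ℝ g x x = 0 := by
  refine (hasDerivAt_comp_smul_one hg).unique ?_
  refine (hasDerivAt_const (1 : ℝ) (g x)).congr_of_eventuallyEq ?_
  filter_upwards [lt_mem_nhds (zero_lt_one (α := ℝ))] with t ht using h t ht

end Homogeneous

/-! ### The Hessian of the energy and its derivative -/

namespace AnisoMinkowski

variable {n : ℕ} {F : Space n → ℝ}

theorem two_le_infty : (2 : WithTop ℕ∞) ≤ ∞ :=
  show ((2 : ℕ∞) : WithTop ℕ∞) ≤ ((⊤ : ℕ∞) : WithTop ℕ∞) from WithTop.coe_le_coe.2 le_top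

/-- The energy `½F²`. -/
noncomputable def energy (F : Space n → ℝ) (y : Space n) : ℝ := (1 / 2 : ℝ) * F y ^ 2

/-- The Hessian of the energy. -/
noncomputable def hess (F : Space n → ℝ) (x : Space n) : Space n →L[ℝ] Space n →L[ℝ] ℝ :=
  fderiv ℝ (fderiv ℝ (energy F)) x

theorem metricG_eq (x ξ η : Space n) : metricG F x ξ η = hess F x ξ η := by
  simp only [metricG, iteratedFDeriv_two_apply]
  rfl

theorem tensorQ_eq (x ξ η ζ : Space n) : tensorQ F x ξ η ζ = fderiv ℝ (hess F) x ξ η ζ := by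
  rw [tensorQ, iteratedFDeriv_succ_apply_right, iteratedFDeriv_two_apply]
  rfl

namespace IsMinkowskiNorm

variable (hF : IsMinkowskiNorm F)
include hF

theorem contDiffAt_energy {x : Space n} (hx : x ≠ 0) : ContDiffAt ℝ ∞ (energy F) x :=
  contDiffAt_const.mul ((hF.contDiffAt hx).pow 2)

theorem contDiffAt_fderiv_energy {x : Space n} (hx : x ≠ 0) :
    ContDiffAt ℝ ∞ (fderiv ℝ (energy F)) x :=
  (hF.contDiffAt_energy hx).fderiv_right (m := ∞) (by simp)

theorem contDiffAt_hess {x : Space n} (hx : x ≠ 0) : ContDiffAt ℝ ∞ (hess F) x :=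
  (hF.contDiffAt_fderiv_energy hx).fderiv_right (m := ∞) (by simp)

theorem energy_smul {r : ℝ} (hr : 0 < r) (x : Space n) :
    energy F (r • x) = (r ^ 2) • energy F x := by
  simp only [energy, hF.homogeneous r hr, smul_eq_mul]; ring

theorem fderiv_energy_smul {r : ℝ} (hr : 0 < r) (x : Space n) :
    fderiv ℝ (energy F) (r • x) = r • fderiv ℝ (energy F) x := by
  rw [fderiv_smul_of_forall_smul hr.ne' (hF.energy_smul hr)]
  congr 1
  field_simp

theorem hess_smul {r : ℝ} (hr : 0 < r) (x : Space n) : hess F (r • x) = hess F x := by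
  rw [hess, fderiv_smul_of_forall_smul hr.ne' (hF.fderiv_energy_smul hr),
    inv_mul_cancel₀ hr.ne', one_smul, hess]

theorem fderiv_smul {r : ℝ} (hr : 0 < r) (x : Space n) : fderiv ℝ F (r • x) = fderiv ℝ F x := by
  rw [fderiv_smul_of_forall_smul hr.ne' (c := r) (fun y => hF.homogeneous r hr y),
    inv_mul_cancel₀ hr.ne', one_smul]

theorem hess_self {x : Space n} (hx : x ≠ 0) : hess F x x = fderiv ℝ (energy F) x :=
  fderiv_self_of_homogeneous_one ((hF.contDiffAt_fderiv_energy hx).differentiableAt (by simp))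
    fun _ hr => hF.fderiv_energy_smul hr x

theorem fderiv_energy {x : Space n} (hx : x ≠ 0) :
    fderiv ℝ (energy F) x = F x • fderiv ℝ F x := by
  have h := ((hF.contDiffAt hx).differentiableAt (by simp)).hasFDerivAt
  have h2 := (h.pow 2).const_mul (1 / 2 : ℝ)
  rw [show energy F = fun y => (1 / 2 : ℝ) * F y ^ 2 from rfl]
  refine h2.fderiv.trans ?_
  ext v
  simp
  ring

theorem hess_self_of_mem {z : Space n} (hz : z ∈ wulff F) : hess F z z = fderiv ℝ F z := by
  rw [hF.hess_self (hF.ne_zero hz), hF.fderiv_energy (hF.ne_zero hz), show F z = 1 from hz,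
    one_smul]

theorem hess_symm {x : Space n} (hx : x ≠ 0) (ξ η : Space n) : hess F x ξ η = hess F x η ξ :=
  (hF.contDiffAt_energy hx).isSymmSndFDerivAt (by simpa using two_le_infty) ξ η

theorem third_symm {x : Space n} (hx : x ≠ 0) (ξ η : Space n) :
    fderiv ℝ (hess F) x ξ η = fderiv ℝ (hess F) x η ξ :=
  (hF.contDiffAt_fderiv_energy hx).isSymmSndFDerivAt (by simpa using two_le_infty) ξ η

/-- Obtained by differentiating the symmetry of the Hessian, which holds on a neighbourhood of x.
Together with `third_symm` it makes Q totally symmetric. -/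
theorem third_symm' {x : Space n} (hx : x ≠ 0) (ξ η ζ : Space n) :
    fderiv ℝ (hess F) x ξ η ζ = fderiv ℝ (hess F) x ξ ζ η := by
  have hd := ((hF.contDiffAt_hess hx).differentiableAt (by simp)).hasFDerivAt
  have h1 : ∀ η ζ, HasFDerivAt (fun y => hess F y η ζ) (((fderiv ℝ (hess F) x).flip η).flip ζ) x := by
    intro η ζ
    have := (hd.clm_apply (hasFDerivAt_const η x)).clm_apply (hasFDerivAt_const ζ x)
    simpa using this
  have h2 := (h1 η ζ).congr_of_eventuallyEq (f₁ := fun y => hess F y ζ η) (by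
    filter_upwards [isOpen_compl_singleton.mem_nhds hx] with y hy
    exact hF.hess_symm hy _ _)
  exact DFunLike.congr_fun (h2.unique (h1 ζ η)) ξ

theorem third_self {x : Space n} (hx : x ≠ 0) : fderiv ℝ (hess F) x x = 0 :=
  fderiv_self_of_homogeneous_zero ((hF.contDiffAt_hess hx).differentiableAt (by simp))
    fun _ hr => hF.hess_smul hr x

theorem third_apply_self {x : Space n} (hx : x ≠ 0) (ξ : Space n) :
    fderiv ℝ (hess F) x ξ x = 0 := by
  rw [hF.third_symm hx, hF.third_self hx, zero_apply]

theorem exists_equiv_hess {x : Space n} (hx : x ≠ 0) :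
    ∃ e : Space n ≃L[ℝ] (Space n →L[ℝ] ℝ), (e : Space n →L[ℝ] Space n →L[ℝ] ℝ) = hess F x := by
  have hinj : Function.Injective (hess F x).toLinearMap := by
    rw [← LinearMap.ker_eq_bot, LinearMap.ker_eq_bot']
    intro ξ hξ
    by_contra hne
    have h := hF.elliptic x hx ξ hne
    rw [metricG_eq] at h
    have h2 : hess F x ξ = 0 := hξ
    rw [h2] at h
    simp at h
  have hfr : Module.finrank ℝ (Space n) = Module.finrank ℝ (Space n →L[ℝ] ℝ) := by
    rw [← (LinearMap.toContinuousLinearMap : (Space n →ₗ[ℝ] ℝ) ≃ₗ[ℝ] _).finrank_eq]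
    exact (Subspace.dual_finrank_eq (K := ℝ) (V := Space n)).symm
  refine ⟨(LinearEquiv.ofInjectiveOfFinrankEq _ hinj hfr).toContinuousLinearEquiv, ?_⟩
  ext; rfl

end IsMinkowskiNorm

/-! ### The Hessian gradient of a function homogeneous of degree one -/

/-- The gradient of `s` with respect to the Hessian metric of the energy. For the homogeneous
extension of a support function this is the position vector of the hypersurface. -/
noncomputable def hessGrad (F s : Space n → ℝ) (x : Space n) : Space n :=
  (hess F x).inverse (fderiv ℝ s x)

namespace IsMinkowskiNorm

variable (hF : IsMinkowskiNorm F) {s : Space n → ℝ}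
include hF

theorem hess_hessGrad {x : Space n} (hx : x ≠ 0) : hess F x (hessGrad F s x) = fderiv ℝ s x := by
  obtain ⟨e, he⟩ := hF.exists_equiv_hess hx
  rw [hessGrad, ← he, ContinuousLinearMap.inverse_equiv]
  simp

theorem contDiffAt_hessGrad {x : Space n} (hx : x ≠ 0) (hs : ContDiffAt ℝ 2 s x) :
    ContDiffAt ℝ 1 (hessGrad F s) x := by
  obtain ⟨e, he⟩ := hF.exists_equiv_hess hx
  have h1 : ContDiffAt ℝ 1 (fun y => (hess F y).inverse) x := by
    have h2 : ContDiffAt ℝ 1 ContinuousLinearMap.inverse (hess F x) := by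
      rw [← he]; exact contDiffAt_map_inverse e
    exact h2.comp x ((hF.contDiffAt_hess hx).of_le (by simp))
  exact h1.clm_apply (hs.fderiv_right (m := 1) (by norm_num))

theorem hessGrad_smul (hs1 : ∀ r : ℝ, 0 < r → ∀ x, s (r • x) = r * s x) {r : ℝ} (hr : 0 < r)
    (x : Space n) : hessGrad F s (r • x) = hessGrad F s x := by
  rw [hessGrad, hessGrad, hF.hess_smul hr,
    fderiv_smul_of_forall_smul hr.ne' (c := r) (fun y => hs1 r hr y), inv_mul_cancel₀ hr.ne',
    one_smul]

theorem fderiv_hessGrad_smul (hs1 : ∀ r : ℝ, 0 < r → ∀ x, s (r • x) = r * s x) {r : ℝ}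
    (hr : 0 < r) (x : Space n) :
    fderiv ℝ (hessGrad F s) (r • x) = r⁻¹ • fderiv ℝ (hessGrad F s) x := by
  rw [fderiv_smul_of_forall_smul hr.ne' (c := 1) (fun y => by
    rw [hF.hessGrad_smul hs1 hr, one_smul]), mul_one]

theorem fderiv_hessGrad_self (hs1 : ∀ r : ℝ, 0 < r → ∀ x, s (r • x) = r * s x) {x : Space n}
    (hx : x ≠ 0) (hs : ContDiffAt ℝ 2 s x) : fderiv ℝ (hessGrad F s) x x = 0 :=
  fderiv_self_of_homogeneous_zero ((hF.contDiffAt_hessGrad hx hs).differentiableAt one_ne_zero)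
    fun _ hr => hF.hessGrad_smul hs1 hr x

/-- This is the product rule applied to G(X, ·) = ds, valid on the open set of nonzero points. -/
theorem hess_fderiv_hessGrad {x : Space n} (hx : x ≠ 0) (hs : ContDiffAt ℝ 2 s x) (ξ : Space n) :
    hess F x (fderiv ℝ (hessGrad F s) x ξ)
      = fderiv ℝ (fderiv ℝ s) x ξ - fderiv ℝ (hess F) x ξ (hessGrad F s x) := by
  have h1 := ((hF.contDiffAt_hess hx).differentiableAt (by simp)).hasFDerivAt
  have h2 := ((hF.contDiffAt_hessGrad hx hs).differentiableAt one_ne_zero).hasFDerivAt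
  have h3 := h1.clm_apply h2
  have h4 : HasFDerivAt (fderiv ℝ s) (fderiv ℝ (fderiv ℝ s) x) x :=
    ((hs.fderiv_right (m := 1) (by norm_num)).differentiableAt one_ne_zero).hasFDerivAt
  have h5 := h4.congr_of_eventuallyEq (f₁ := fun y => hess F y (hessGrad F s y)) (by
    filter_upwards [isOpen_compl_singleton.mem_nhds hx] with y hy
    exact hF.hess_hessGrad hy)
  have h6 := DFunLike.congr_fun (h5.unique h3) ξ
  rw [h6]
  simp

omit hF in
theorem fderiv_fderiv_self (hs1 : ∀ r : ℝ, 0 < r → ∀ x, s (r • x) = r * s x) {x : Space n}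
    (hs : ContDiffAt ℝ 2 s x) (ξ : Space n) : fderiv ℝ (fderiv ℝ s) x ξ x = 0 := by
  have h := hs.isSymmSndFDerivAt (by simp) ξ x
  rw [h, fderiv_self_of_homogeneous_zero (g := fderiv ℝ s)
    ((hs.fderiv_right (m := 1) (by norm_num)).differentiableAt one_ne_zero), zero_apply]
  intro r hr
  rw [fderiv_smul_of_forall_smul hr.ne' (c := r) (fun y => hs1 r hr y), inv_mul_cancel₀ hr.ne',
    one_smul]

/-- Both terms of `hess_fderiv_hessGrad` vanish on the radial direction: ds and G are homogeneous of
degree zero. Hence DX maps into the tangent space. -/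
theorem hess_self_fderiv_hessGrad (hs1 : ∀ r : ℝ, 0 < r → ∀ x, s (r • x) = r * s x)
    {x : Space n} (hx : x ≠ 0) (hs : ContDiffAt ℝ 2 s x) (ξ : Space n) :
    hess F x x (fderiv ℝ (hessGrad F s) x ξ) = 0 := by
  rw [hF.hess_symm hx, hF.hess_fderiv_hessGrad hx hs, sub_apply, fderiv_fderiv_self hs1 hs,
    hF.third_symm' hx, hF.third_apply_self hx, zero_apply, sub_zero]

end IsMinkowskiNorm

/-! ### Covariant derivatives in orthonormal coordinates -/

theorem pderiv_clm_comp {V W : Type*} [NormedAddCommGroup V] [NormedSpace ℝ V]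
    [NormedAddCommGroup W] [NormedSpace ℝ W] {T : Space n → V →L[ℝ] W} {φ : (Fin n → ℝ) → Space n}
    {w : (Fin n → ℝ) → V} {u : Fin n → ℝ} (hT : DifferentiableAt ℝ T (φ u))
    (hφ : DifferentiableAt ℝ φ u) (hw : DifferentiableAt ℝ w u) (i : Fin n) :
    pderiv i (fun y => T (φ y) (w y)) u
      = fderiv ℝ T (φ u) (pderiv i φ u) (w u) + T (φ u) (pderiv i w u) := by
  have h := (hT.hasFDerivAt.comp u hφ.hasFDerivAt).clm_apply hw.hasFDerivAt
  have h2 : fderiv ℝ (fun y => T (φ y) (w y)) u = _ := h.fderiv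
  rw [pderiv, h2]
  simp [pderiv, add_comm]

namespace IsOrthonormalCoords

variable {z : Space n} {φ : (Fin n → ℝ) → Space n}

theorem mem (hφ : IsOrthonormalCoords F z φ) : z ∈ wulff F := by
  have := hφ.mem_wulff.self_of_nhds
  rwa [hφ.center] at this

theorem contDiffAt_pderiv (hφ : IsOrthonormalCoords F z φ) (j : Fin n) :
    ContDiffAt ℝ ∞ (pderiv j φ) 0 :=
  (hφ.smooth.fderiv_right (m := ∞) (by simp)).clm_apply contDiffAt_const

theorem pderiv_pderiv_comm (hφ : IsOrthonormalCoords F z φ) (i j : Fin n) :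
    pderiv i (pderiv j φ) 0 = pderiv j (pderiv i φ) 0 := by
  have h : ∀ i j, pderiv i (pderiv j φ) 0
      = fderiv ℝ (fderiv ℝ φ) 0 (Pi.single i 1) (Pi.single j 1) := by
    intro i j
    have h1 := ((hφ.smooth.fderiv_right (m := ∞) (by simp)).differentiableAt
      (by simp)).hasFDerivAt.clm_apply (hasFDerivAt_const (Pi.single j (1 : ℝ)) (0 : Fin n → ℝ))
    change fderiv ℝ (fun u => fderiv ℝ φ u (Pi.single j 1)) 0 (Pi.single i 1) = _
    rw [h1.fderiv]
    simp
  rw [h, h]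
  exact hφ.smooth.isSymmSndFDerivAt (by simpa using two_le_infty) _ _

theorem eventually_differentiableAt (hφ : IsOrthonormalCoords F z φ) :
    ∀ᶠ u in 𝓝 0, DifferentiableAt ℝ φ u := by
  have := (hφ.smooth.of_le (show (1 : WithTop ℕ∞) ≤ ∞ by simp)).eventually (by simp)
  filter_upwards [this] with u hu using hu.differentiableAt one_ne_zero

/-- First derivatives of a function composed with the coordinates. -/
theorem pderiv_comp_eventuallyEq (hF : IsMinkowskiNorm F) (hφ : IsOrthonormalCoords F z φ)
    {s S : Space n → ℝ} (hs : ∀ x, x ≠ 0 → DifferentiableAt ℝ s x)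
    (hS : ∀ x ∈ wulff F, S x = s x) (j : Fin n) :
    pderiv j (fun u => S (φ u)) =ᶠ[𝓝 0] fun u => fderiv ℝ s (φ u) (pderiv j φ u) := by
  have h1 : (fun u => S (φ u)) =ᶠ[𝓝 0] fun u => s (φ u) := by
    filter_upwards [hφ.mem_wulff] with u hu using hS _ hu
  filter_upwards [hφ.mem_wulff, h1.eventuallyEq_nhds, hφ.eventually_differentiableAt] with u hu h2 h3
  rw [pderiv, h2.fderiv_eq]
  have := (hs _ (hF.ne_zero hu)).hasFDerivAt.comp u h3.hasFDerivAt
  have h4 : fderiv ℝ (fun u => s (φ u)) u = _ := this.fderiv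
  rw [h4]
  rfl

/-- Second derivatives of a function composed with the coordinates. -/
theorem pderiv_pderiv_comp (hF : IsMinkowskiNorm F) (hφ : IsOrthonormalCoords F z φ)
    {s S : Space n → ℝ} (hs : ∀ x, x ≠ 0 → ContDiffAt ℝ 2 s x)
    (hS : ∀ x ∈ wulff F, S x = s x) (i j : Fin n) :
    pderiv i (pderiv j (fun u => S (φ u))) 0
      = fderiv ℝ (fderiv ℝ s) z (pderiv i φ 0) (pderiv j φ 0)
        + fderiv ℝ s z (pderiv i (pderiv j φ) 0) := by
  have h := hφ.pderiv_comp_eventuallyEq hF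
    (fun x hx => (hs x hx).differentiableAt two_ne_zero) hS j
  have hz := hF.ne_zero hφ.mem
  rw [pderiv, h.fderiv_eq]
  have h2 := pderiv_clm_comp (T := fderiv ℝ s) (φ := φ) (w := pderiv j φ) (u := 0)
    (by
      rw [hφ.center]
      exact ((hs z hz).fderiv_right (m := 1) (by norm_num)).differentiableAt one_ne_zero)
    (hφ.smooth.differentiableAt (by simp)) ((hφ.contDiffAt_pderiv j).differentiableAt (by simp)) i
  rw [hφ.center] at h2
  exact h2

theorem energy_eq_half {x : Space n} (hx : x ∈ wulff F) : energy F x = 1 / 2 := by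
  rw [energy, show F x = 1 from hx]; norm_num

theorem fderiv_energy_pderiv (hF : IsMinkowskiNorm F) (hφ : IsOrthonormalCoords F z φ)
    (j : Fin n) : fderiv ℝ (energy F) z (pderiv j φ 0) = 0 := by
  have h := hφ.pderiv_comp_eventuallyEq hF (s := energy F) (S := fun _ => 1 / 2)
    (fun x hx => (hF.contDiffAt_energy hx).differentiableAt (by simp))
    (fun x hx => (energy_eq_half hx).symm) j
  have h2 := h.self_of_nhds
  simp only [hφ.center] at h2
  rw [← h2]
  simp [pderiv]

/-- The energy is constant along the coordinates; its second derivative along them gives the Gauss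
formula, in which the radial part of ∂_i∂_jφ is -δ_ij z. This is the origin of the term S δ_ij. -/
theorem fderiv_energy_pderiv_pderiv (hF : IsMinkowskiNorm F) (hφ : IsOrthonormalCoords F z φ)
    (i j : Fin n) : fderiv ℝ (energy F) z (pderiv i (pderiv j φ) 0) = - if i = j then 1 else 0 := by
  have h := hφ.pderiv_pderiv_comp hF (s := energy F) (S := fun _ => 1 / 2)
    (fun x hx => (hF.contDiffAt_energy hx).of_le two_le_infty)
    (fun x hx => (energy_eq_half hx).symm) i j
  have h2 : pderiv i (pderiv j (fun _ : Fin n → ℝ => (1 / 2 : ℝ))) 0 = 0 := by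
    have : pderiv j (fun _ : Fin n → ℝ => (1 / 2 : ℝ)) = fun _ => 0 := by
      funext u; simp [pderiv]
    rw [this]; simp [pderiv]
  rw [h2] at h
  have h3 := hφ.orthonormal i j
  rw [metricG_eq] at h3
  change 0 = hess F z _ _ + _ at h
  rw [h3] at h
  linarith

theorem pderiv_gram (hF : IsMinkowskiNorm F) (hφ : IsOrthonormalCoords F z φ) (i j l : Fin n) :
    pderiv i (fun w => gram F φ w j l) 0
      = fderiv ℝ (hess F) z (pderiv i φ 0) (pderiv j φ 0) (pderiv l φ 0)
        + hess F z (pderiv i (pderiv j φ) 0) (pderiv l φ 0)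
        + hess F z (pderiv j φ 0) (pderiv i (pderiv l φ) 0) := by
  have hz := hF.ne_zero hφ.mem
  have hφd := hφ.smooth.differentiableAt (by simp)
  have hT : DifferentiableAt ℝ (hess F) (φ 0) := by
    rw [hφ.center]; exact (hF.contDiffAt_hess hz).differentiableAt (by simp)
  have hd := fun j => (hφ.contDiffAt_pderiv j).differentiableAt (by simp)
  have h1 : HasFDerivAt (fun w => hess F (φ w) (pderiv j φ w) (pderiv l φ w)) _ 0 :=
    ((hT.hasFDerivAt.comp 0 hφd.hasFDerivAt).clm_apply (hd j).hasFDerivAt).clm_apply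
      (hd l).hasFDerivAt
  have h2 : (fun w => gram F φ w j l)
      = fun w => hess F (φ w) (pderiv j φ w) (pderiv l φ w) := by
    funext w; simp [gram, metricG_eq]
  rw [h2, pderiv, h1.fderiv]
  simp [hφ.center, pderiv]
  ring

/-- The Gram matrix is the identity at the centre only, so its inverse drops out while its
derivatives remain. Of the three Q terms in these derivatives two cancel, leaving the factor ½. -/
theorem christoffel_eq (hF : IsMinkowskiNorm F) (hφ : IsOrthonormalCoords F z φ)
    (i j k : Fin n) :
    christoffel F φ i j k 0 = hess F z (pderiv k φ 0) (pderiv i (pderiv j φ) 0)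
      + (1 / 2) * fderiv ℝ (hess F) z (pderiv i φ 0) (pderiv j φ 0) (pderiv k φ 0) := by
  have hz := hF.ne_zero hφ.mem
  have hg : gram F φ 0 = 1 := by
    ext a b
    rw [gram, Matrix.of_apply, hφ.center, hφ.orthonormal, Matrix.one_apply]
  rw [christoffel, hg, inv_one]
  simp only [Matrix.one_apply, ite_mul, one_mul, zero_mul, Finset.sum_ite_eq, Finset.mem_univ,
    if_true, hφ.pderiv_gram hF]
  rw [hF.third_symm hz (pderiv j φ 0) (pderiv i φ 0),
    hF.third_symm hz (pderiv k φ 0) (pderiv i φ 0),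
    hF.third_symm' hz (pderiv i φ 0) (pderiv k φ 0), hφ.pderiv_pderiv_comm j i,
    hφ.pderiv_pderiv_comm k i, hφ.pderiv_pderiv_comm k j,
    hF.hess_symm hz (pderiv i (pderiv k φ) 0), hF.hess_symm hz (pderiv i (pderiv j φ) 0)]
  ring

/-- The position vector and the coordinate vectors are orthonormal for the Hessian metric. -/
theorem hess_cons (hF : IsMinkowskiNorm F) (hφ : IsOrthonormalCoords F z φ)
    (i j : Fin (n + 1)) :
    hess F z ((Fin.cons z fun k => pderiv k φ 0 : Fin (n + 1) → Space n) i)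
      ((Fin.cons z fun k => pderiv k φ 0 : Fin (n + 1) → Space n) j) = if i = j then 1 else 0 := by
  have hz := hF.ne_zero hφ.mem
  induction i using Fin.cases with
  | zero =>
    induction j using Fin.cases with
    | zero =>
      rw [Fin.cons_zero, hF.hess_self_of_mem hφ.mem, hF.fderiv_self hφ.mem, if_pos rfl]
    | succ j =>
      rw [Fin.cons_zero, Fin.cons_succ, hF.hess_self hz, hφ.fderiv_energy_pderiv hF,
        if_neg (Fin.succ_ne_zero j).symm]
  | succ i =>
    induction j using Fin.cases with
    | zero =>
      rw [Fin.cons_zero, Fin.cons_succ, hF.hess_symm hz, hF.hess_self hz,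
        hφ.fderiv_energy_pderiv hF, if_neg (Fin.succ_ne_zero i)]
    | succ j =>
      rw [Fin.cons_succ, Fin.cons_succ, ← metricG_eq, hφ.orthonormal]
      simp [Fin.succ_inj]

theorem eq_smul_add_sum (hF : IsMinkowskiNorm F) (hφ : IsOrthonormalCoords F z φ)
    (w : Space n) : w = hess F z z w • z
      + ∑ k, hess F z (pderiv k φ 0) w • pderiv k φ 0 := by
  have := sum_bilin_smul (hess F z) (hφ.hess_cons hF) (by simp) w
  rw [Fin.sum_univ_succ] at this
  simp only [Fin.cons_zero, Fin.cons_succ] at this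
  exact this.symm

/-- The matrix `S_ij - ½ Q_ijk S_k + S δ_ij` is the matrix of the differential of the
Hessian gradient of the homogeneous extension of `S`. -/
theorem uMatrix_eq (hF : IsMinkowskiNorm F) (hφ : IsOrthonormalCoords F z φ)
    {s S : Space n → ℝ} (hs : ∀ x, x ≠ 0 → ContDiffAt ℝ 2 s x)
    (hs1 : ∀ r : ℝ, 0 < r → ∀ x, s (r • x) = r * s x) (hS : ∀ x ∈ wulff F, S x = s x)
    (i j : Fin n) : uMatrix F φ S i j
      = hess F z (fderiv ℝ (hessGrad F s) z (pderiv i φ 0)) (pderiv j φ 0) := by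
  have hz := hF.ne_zero hφ.mem
  have hsd := (hs z hz).differentiableAt two_ne_zero
  have hcov1 : ∀ k, cov1 φ S k 0 = fderiv ℝ s z (pderiv k φ 0) := by
    intro k
    have := (hφ.pderiv_comp_eventuallyEq hF
      (fun x hx => (hs x hx).differentiableAt two_ne_zero) hS k).self_of_nhds
    simp only [hφ.center] at this
    exact this
  have hself : fderiv ℝ s z z = s z := by
    have := fderiv_self_of_homogeneous_one hsd (fun r hr => hs1 r hr z)
    exact this
  have hP := congrArg (fderiv ℝ s z) (hφ.eq_smul_add_sum hF (pderiv i (pderiv j φ) 0))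
  rw [map_add, map_smul, map_sum, hF.hess_self hz, hφ.fderiv_energy_pderiv_pderiv hF, hself] at hP
  -- The tangential components of X are the S_k. Its radial part is invisible to Q, so Q(e_i, X,
  -- e_j) is the sum of the Q_ijk S_k.
  have hX := hφ.eq_smul_add_sum hF (hessGrad F s z)
  have hXk : ∀ w, hess F z w (hessGrad F s z) = fderiv ℝ s z w := by
    intro w
    rw [hF.hess_symm hz, hF.hess_hessGrad hz]
  simp only [hXk] at hX
  have hQ : fderiv ℝ (hess F) z (pderiv i φ 0) (hessGrad F s z) (pderiv j φ 0)
      = ∑ k, fderiv ℝ s z (pderiv k φ 0) *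
        fderiv ℝ (hess F) z (pderiv i φ 0) (pderiv j φ 0) (pderiv k φ 0) := by
    rw [hX, map_add, map_smul, hF.third_apply_self hz, smul_zero, zero_add, map_sum,
      sum_apply]
    refine Finset.sum_congr rfl fun k _ => ?_
    rw [map_smul, smul_apply, smul_eq_mul, hF.third_symm' hz]
  rw [hF.hess_fderiv_hessGrad hz (hs z hz), sub_apply, hQ, uMatrix, Matrix.of_apply, cov2]
  have h2 : pderiv i (cov1 φ S j) 0 = _ := hφ.pderiv_pderiv_comp hF hs hS i j
  rw [h2, hP]
  -- The ½ Q_ijk S_k from the Christoffel symbols and the explicit ½ Q_ijk S_k in `uMatrix` add up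
  -- to the full contraction in `hQ`.
  simp only [hcov1, hφ.christoffel_eq hF, hφ.center, tensorQ_eq, hS z hφ.mem, map_smul,
    smul_eq_mul, add_mul, Finset.sum_add_distrib, Finset.mul_sum]
  have e1 : ∀ k, (1 / 2 : ℝ) * fderiv ℝ (hess F) z (pderiv i φ 0) (pderiv j φ 0) (pderiv k φ 0) *
      fderiv ℝ s z (pderiv k φ 0) = (1 / 2 : ℝ) * (fderiv ℝ (hess F) z (pderiv i φ 0)
        (pderiv j φ 0) (pderiv k φ 0) * fderiv ℝ s z (pderiv k φ 0)) := fun k => mul_assoc _ _ _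
  have e2 : ∀ k, fderiv ℝ s z (pderiv k φ 0) * fderiv ℝ (hess F) z (pderiv i φ 0) (pderiv j φ 0)
      (pderiv k φ 0) = fderiv ℝ (hess F) z (pderiv i φ 0) (pderiv j φ 0) (pderiv k φ 0) *
        fderiv ℝ s z (pderiv k φ 0) := fun k => mul_comm _ _
  simp only [e1, e2, ← Finset.mul_sum]
  ring

/-- Jacobian determinant of the Hessian gradient, perturbed in a radial direction. -/
theorem det_fderiv_hessGrad (hF : IsMinkowskiNorm F) (hφ : IsOrthonormalCoords F z φ)
    {s S : Space n → ℝ} (hs : ∀ x, x ≠ 0 → ContDiffAt ℝ 2 s x)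
    (hs1 : ∀ r : ℝ, 0 < r → ∀ x, s (r • x) = r * s x) (hS : ∀ x ∈ wulff F, S x = s x)
    (a : ℝ) (y : Space n) :
    (a • fderiv ℝ (hessGrad F s) z + (fderiv ℝ F z).smulRight y).det
      = a ^ n * (fderiv ℝ F z y * (uMatrix F φ S).det) := by
  have hz := hF.ne_zero hφ.mem
  have h := det_smul_add_smulRight (hess F z) (hφ.hess_cons hF) (by simp)
    (fderiv ℝ (hessGrad F s) z)
    (by rw [Fin.cons_zero]; exact hF.fderiv_hessGrad_self hs1 hz (hs z hz))
    (by
      intro ξ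
      rw [Fin.cons_zero]
      exact hF.hess_self_fderiv_hessGrad hs1 hz (hs z hz) ξ) a y
  rw [Fin.cons_zero, hF.hess_self_of_mem hφ.mem] at h
  rw [h]
  congr 2
  -- `uMatrix` pairs DX e_i with e_j, whereas the matrix of the operator pairs e_i with DX e_j.
  rw [← Matrix.det_transpose]
  congr 1
  ext i j
  rw [Matrix.transpose_apply, Matrix.of_apply, Fin.cons_succ, Fin.cons_succ,
    hφ.uMatrix_eq hF hs hs1 hS, hF.hess_symm hz]

end IsOrthonormalCoords

/-! ### Radial projection and homogeneous extension -/

/-- The radial projection to the Wulff shape. -/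
noncomputable def radialProj (F : Space n → ℝ) (x : Space n) : Space n := (F x)⁻¹ • x

/-- The extension of a function on the Wulff shape that is homogeneous of degree one. -/
noncomputable def homExt (F S : Space n → ℝ) (x : Space n) : ℝ := F x * S (radialProj F x)

namespace IsMinkowskiNorm

variable (hF : IsMinkowskiNorm F)
include hF

theorem map_zero : F 0 = 0 := by
  have h := hF.homogeneous 2 two_pos 0
  rw [smul_zero] at h
  linarith

theorem nonneg (x : Space n) : 0 ≤ F x := by
  by_cases hx : x = 0
  · rw [hx, hF.map_zero]
  · exact (hF.pos x hx).le

theorem eq_norm_mul {x : Space n} (hx : x ≠ 0) : F x = ‖x‖ * F (‖x‖⁻¹ • x) := by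
  rw [← hF.homogeneous _ (norm_pos_iff.2 hx), smul_smul,
    mul_inv_cancel₀ (norm_ne_zero_iff.2 hx), one_smul]

omit hF in
theorem inv_norm_smul_mem_sphere {x : Space n} (hx : x ≠ 0) :
    ‖x‖⁻¹ • x ∈ Metric.sphere (0 : Space n) 1 := by
  rw [mem_sphere_zero_iff_norm, norm_smul, norm_inv, norm_norm,
    inv_mul_cancel₀ (norm_ne_zero_iff.2 hx)]

theorem continuousOn_sphere : ContinuousOn F (Metric.sphere (0 : Space n) 1) :=
  hF.smooth.continuousOn.mono fun x hx => by
    rintro rfl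
    simp at hx

theorem exists_lower_bound : ∃ m : ℝ, 0 < m ∧ ∀ x, m * ‖x‖ ≤ F x := by
  obtain ⟨m, hm, h⟩ := (isCompact_sphere (0 : Space n) 1).exists_forall_le' hF.continuousOn_sphere
    (a := 0) (fun x hx => hF.pos x (by rintro rfl; simp at hx))
  refine ⟨m, hm, fun x => ?_⟩
  by_cases hx : x = 0
  · simp [hx, hF.map_zero]
  · rw [hF.eq_norm_mul hx, mul_comm]
    exact mul_le_mul_of_nonneg_left (h _ (inv_norm_smul_mem_sphere hx)) (norm_nonneg x)

theorem exists_upper_bound : ∃ M : ℝ, ∀ x, F x ≤ M * ‖x‖ := by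
  obtain ⟨M, h⟩ := (isCompact_sphere (0 : Space n) 1).exists_bound_of_continuousOn
    hF.continuousOn_sphere
  refine ⟨M, fun x => ?_⟩
  by_cases hx : x = 0
  · simp [hx, hF.map_zero]
  · rw [hF.eq_norm_mul hx, mul_comm]
    exact mul_le_mul_of_nonneg_right
      ((le_abs_self _).trans (h _ (inv_norm_smul_mem_sphere hx))) (norm_nonneg x)

theorem continuous : Continuous F := by
  rw [continuous_iff_continuousAt]
  intro x
  by_cases hx : x = 0
  · subst hx
    obtain ⟨M, hM⟩ := hF.exists_upper_bound
    rw [ContinuousAt, hF.map_zero]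
    refine squeeze_zero (fun x => hF.nonneg x) hM ?_
    have : Continuous fun x : Space n => M * ‖x‖ := by fun_prop
    simpa using this.tendsto 0
  · exact (hF.contDiffAt hx).continuousAt

theorem measurableSet_wulff : MeasurableSet (wulff F) :=
  (isClosed_eq hF.continuous continuous_const).measurableSet

theorem radialProj_mem {x : Space n} (hx : x ≠ 0) : radialProj F x ∈ wulff F := by
  have hp := hF.pos x hx
  change F ((F x)⁻¹ • x) = 1
  rw [hF.homogeneous _ (inv_pos.2 hp), inv_mul_cancel₀ hp.ne']

theorem smul_radialProj {x : Space n} (hx : x ≠ 0) : F x • radialProj F x = x := by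
  rw [radialProj, smul_smul, mul_inv_cancel₀ (hF.pos x hx).ne', one_smul]

theorem radialProj_smul {r : ℝ} (hr : 0 < r) (x : Space n) :
    radialProj F (r • x) = radialProj F x := by
  rw [radialProj, radialProj, hF.homogeneous r hr, smul_smul]
  congr 1
  field_simp

omit hF in
theorem radialProj_of_mem {z : Space n} (hz : z ∈ wulff F) : radialProj F z = z := by
  rw [radialProj, show F z = 1 from hz, inv_one, one_smul]

theorem contDiffAt_radialProj {x : Space n} (hx : x ≠ 0) : ContDiffAt ℝ ∞ (radialProj F) x :=
  ((hF.contDiffAt hx).inv (hF.pos x hx).ne').smul contDiffAt_id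

theorem measurable_radialProj : Measurable (radialProj F) :=
  hF.continuous.measurable.inv.smul measurable_id

theorem homExt_smul (S : Space n → ℝ) (r : ℝ) (hr : 0 < r) (x : Space n) :
    homExt F S (r • x) = r * homExt F S x := by
  rw [homExt, homExt, hF.radialProj_smul hr, hF.homogeneous r hr, mul_assoc]

omit hF in
theorem homExt_of_mem (S : Space n → ℝ) {z : Space n} (hz : z ∈ wulff F) :
    S z = homExt F S z := by
  rw [homExt, radialProj_of_mem hz, show F z = 1 from hz, one_mul]

theorem contDiffAt_homExt {S : Space n → ℝ} (hS : IsC2OnHypersurface (wulff F) S) (x : Space n)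
    (hx : x ≠ 0) : ContDiffAt ℝ 2 (homExt F S) x := by
  obtain ⟨T, hT, hST⟩ := hS _ (hF.radialProj_mem hx)
  have h1 := hF.contDiffAt_radialProj hx
  have h2 : ContDiffAt ℝ 2 (fun y => F y * T (radialProj F y)) x :=
    ((hF.contDiffAt hx).of_le two_le_infty).mul (hT.comp x (h1.of_le two_le_infty))
  refine h2.congr_of_eventuallyEq ?_
  have h3 : Tendsto (radialProj F) (𝓝 x) (𝓝[wulff F] radialProj F x) := by
    refine tendsto_nhdsWithin_iff.2 ⟨h1.continuousAt, ?_⟩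
    filter_upwards [isOpen_compl_singleton.mem_nhds hx] with y hy using hF.radialProj_mem hy
  filter_upwards [h3.eventually hST] with y hy
  rw [homExt, hy]

end IsMinkowskiNorm

/-! ### Radial cutoffs -/

/-- A smooth cutoff, equal to `1` on `[1, 2]` and to `0` near `0` and near infinity. -/
noncomputable def annulusCutoff : ContDiffBump (3 / 2 : ℝ) :=
  ⟨1 / 2, 1, by norm_num, by norm_num⟩

/-- A smooth decreasing function, equal to `1` before `1` and to `0` after `2`. -/
noncomputable def ballCutoff (r : ℝ) : ℝ := Real.smoothTransition (2 - r)

/-- The radial weight produced by `ballCutoff`. -/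
noncomputable def radialWeight (n : ℕ) (r : ℝ) : ℝ := -deriv ballCutoff r * (r⁻¹) ^ n

theorem contDiff_ballCutoff : ContDiff ℝ ∞ ballCutoff :=
  Real.smoothTransition.contDiff.comp (contDiff_const.sub contDiff_id)

theorem ballCutoff_of_le {r : ℝ} (hr : r ≤ 1) : ballCutoff r = 1 :=
  Real.smoothTransition.one_of_one_le (by linarith)

theorem ballCutoff_of_ge {r : ℝ} (hr : 2 ≤ r) : ballCutoff r = 0 :=
  Real.smoothTransition.zero_of_nonpos (by linarith)

theorem annulusCutoff_eq_one {r : ℝ} (h1 : 1 ≤ r) (h2 : r ≤ 2) : annulusCutoff r = 1 :=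
  annulusCutoff.one_of_mem_closedBall (by
    rw [Metric.mem_closedBall, Real.dist_eq, abs_le]
    change -(1 / 2 : ℝ) ≤ _ ∧ _ ≤ (1 / 2 : ℝ)
    constructor <;> linarith)

theorem annulusCutoff_of_le {r : ℝ} (hr : r ≤ 1 / 2) : annulusCutoff r = 0 :=
  annulusCutoff.zero_of_le_dist (by
    rw [Real.dist_eq, abs_of_nonpos (by linarith)]
    change (1 : ℝ) ≤ _
    linarith)

theorem annulusCutoff_of_ge {r : ℝ} (hr : 5 / 2 ≤ r) : annulusCutoff r = 0 :=
  annulusCutoff.zero_of_le_dist (by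
    rw [Real.dist_eq, abs_of_nonneg (by linarith)]
    change (1 : ℝ) ≤ _
    linarith)

theorem deriv_ballCutoff_of_lt {r : ℝ} (hr : r < 1) : deriv ballCutoff r = 0 := by
  have : ballCutoff =ᶠ[𝓝 r] fun _ => 1 := by
    filter_upwards [gt_mem_nhds hr] with t ht using ballCutoff_of_le ht.le
  rw [this.deriv_eq, deriv_const]

theorem deriv_ballCutoff_of_gt {r : ℝ} (hr : 2 < r) : deriv ballCutoff r = 0 := by
  have : ballCutoff =ᶠ[𝓝 r] fun _ => 0 := by
    filter_upwards [lt_mem_nhds hr] with t ht using ballCutoff_of_ge ht.le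
  rw [this.deriv_eq, deriv_const]

theorem deriv_ballCutoff_nonpos (r : ℝ) : deriv ballCutoff r ≤ 0 := by
  have : Antitone ballCutoff := fun a b hab =>
    Real.smoothTransition.monotone (by linarith)
  exact this.deriv_nonpos

theorem radialWeight_nonneg (n : ℕ) {r : ℝ} (hr : 0 ≤ r) : 0 ≤ radialWeight n r :=
  mul_nonneg (neg_nonneg.2 (deriv_ballCutoff_nonpos r)) (by positivity)

theorem measurable_radialWeight (n : ℕ) : Measurable (radialWeight n) :=
  (measurable_deriv _).neg.mul (measurable_inv.pow_const n)

theorem deriv_mul_annulusCutoff_pow (n : ℕ) (r : ℝ) :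
    deriv ballCutoff r * (annulusCutoff r * r⁻¹) ^ n = -radialWeight n r := by
  rw [radialWeight, neg_mul, neg_neg]
  rcases lt_or_ge r 1 with h1 | h1
  · rw [deriv_ballCutoff_of_lt h1, zero_mul, zero_mul]
  rcases lt_or_ge 2 r with h2 | h2
  · rw [deriv_ballCutoff_of_gt h2, zero_mul, zero_mul]
  rw [annulusCutoff_eq_one h1 h2, one_mul]

/-- The integrand is -χ', and χ drops from 1 to 0. This normalization is why the cone measure equals
μ with no constant. -/
theorem lintegral_radialWeight (n : ℕ) :
    ∫⁻ r in Ioi (0 : ℝ), ENNReal.ofReal (r ^ n * radialWeight n r) = 1 := by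
  have hc : Continuous (deriv ballCutoff) := contDiff_ballCutoff.continuous_deriv (by simp)
  have h1 : ∫⁻ r in Ioi (0 : ℝ), ENNReal.ofReal (r ^ n * radialWeight n r)
      = ∫⁻ r in Ioc (0 : ℝ) 3, ENNReal.ofReal (-deriv ballCutoff r) := by
    rw [← lintegral_indicator measurableSet_Ioi, ← lintegral_indicator measurableSet_Ioc]
    refine lintegral_congr fun r => ?_
    by_cases h0 : 0 < r
    · rw [indicator_of_mem (show r ∈ Ioi (0 : ℝ) from h0), radialWeight, inv_pow, mul_comm,
        mul_assoc, inv_mul_cancel₀ (pow_pos h0 n).ne', mul_one]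
      by_cases h3 : r ≤ 3
      · rw [indicator_of_mem (show r ∈ Ioc (0 : ℝ) 3 from ⟨h0, h3⟩)]
      · rw [indicator_of_notMem (fun h => h3 h.2), deriv_ballCutoff_of_gt (by linarith)]
        simp
    · rw [indicator_of_notMem (show r ∉ Ioi (0 : ℝ) from h0), indicator_of_notMem fun h => h0 h.1]
  have h2 : IntegrableOn (fun r => -deriv ballCutoff r) (Ioc 0 3) :=
    hc.neg.integrableOn_Icc.mono_set Ioc_subset_Icc_self
  rw [h1, ← ofReal_integral_eq_lintegral_ofReal h2
    (ae_of_all _ fun r => neg_nonneg.2 (deriv_ballCutoff_nonpos r)),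
    ← intervalIntegral.integral_of_le (by norm_num), intervalIntegral.integral_neg,
    intervalIntegral.integral_deriv_eq_sub
      (fun r _ => (contDiff_ballCutoff.differentiable (by simp)) r)
      (hc.intervalIntegrable _ _), ballCutoff_of_le zero_le_one, ballCutoff_of_ge (by norm_num)]
  simp

/-! ### The compactly supported test map and its Jacobian -/

/-- The cut off position map, moved by a multiple of `E`. -/
noncomputable def cutoffMap (F s : Space n → ℝ) (E : Space n) (a : ℝ) (x : Space n) : Space n :=
  annulusCutoff (F x) • hessGrad F s x + (a * ballCutoff (F x)) • E

section cutoffMap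

variable (hF : IsMinkowskiNorm F) {s : Space n → ℝ} (hs : ∀ x, x ≠ 0 → ContDiffAt ℝ 2 s x)
  (E : Space n) (a : ℝ)
include hF

theorem hasCompactSupport_cutoffMap : HasCompactSupport (cutoffMap F s E a) := by
  obtain ⟨m, hm, h⟩ := hF.exists_lower_bound
  refine HasCompactSupport.intro (isCompact_closedBall (0 : Space n) (5 / 2 / m)) fun x hx => ?_
  have h1 : 5 / 2 ≤ F x := by
    refine le_trans ?_ (h x)
    rw [mem_closedBall_zero_iff, not_le, div_lt_iff₀ hm] at hx
    linarith
  rw [cutoffMap, annulusCutoff_of_ge h1, ballCutoff_of_ge (by linarith)]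
  simp

include hs

theorem contDiff_cutoffMap : ContDiff ℝ 1 (cutoffMap F s E a) := by
  rw [contDiff_iff_contDiffAt]
  intro x
  by_cases hx : x = 0
  · subst hx
    -- X is singular at the origin, but near it η vanishes and χ = 1, so the map is constant there.
    refine (contDiffAt_const (c := a • E)).congr_of_eventuallyEq ?_
    have h1 : ∀ᶠ y in 𝓝 (0 : Space n), F y < 1 / 2 :=
      hF.continuous.continuousAt.eventually (gt_mem_nhds (by rw [hF.map_zero]; norm_num))
    filter_upwards [h1] with y hy
    rw [cutoffMap, annulusCutoff_of_le hy.le, ballCutoff_of_le (by linarith)]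
    simp
  · have h1 : ContDiffAt ℝ 1 F x := (hF.contDiffAt hx).of_le (by simp)
    have h2 : ContDiffAt ℝ 1 (fun y => annulusCutoff (F y)) x :=
      (annulusCutoff.contDiff (n := 1)).contDiffAt.comp x h1
    have h3 : ContDiffAt ℝ 1 (fun y => ballCutoff (F y)) x :=
      (contDiff_ballCutoff.of_le (by simp)).contDiffAt.comp x h1
    exact (h2.smul (hF.contDiffAt_hessGrad hx (hs x hx))).add
      ((contDiffAt_const.mul h3).smul contDiffAt_const)

variable (hs1 : ∀ r : ℝ, 0 < r → ∀ x, s (r • x) = r * s x)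
include hs1

/-- Both cutoffs depend on x through F only, so their derivatives combine into one rank one term
along dF; homogeneity moves DX and dF to the Wulff shape. -/
theorem fderiv_cutoffMap {x : Space n} (hx : x ≠ 0) :
    fderiv ℝ (cutoffMap F s E a) x
      = (annulusCutoff (F x) * (F x)⁻¹) • fderiv ℝ (hessGrad F s) (radialProj F x)
        + (fderiv ℝ F (radialProj F x)).smulRight
          (deriv annulusCutoff (F x) • hessGrad F s x + (a * deriv ballCutoff (F x)) • E) := by
  have hr := hF.pos x hx
  have h1 := ((hF.contDiffAt hx).differentiableAt (by simp)).hasFDerivAt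
  have h2 : HasFDerivAt (fun y => annulusCutoff (F y)) _ x :=
    ((annulusCutoff.contDiff (n := 1)).differentiable (by simp)
      (F x)).hasDerivAt.comp_hasFDerivAt x h1
  have h3 : HasFDerivAt (fun y => ballCutoff (F y)) _ x :=
    (contDiff_ballCutoff.differentiable (by simp) (F x)).hasDerivAt.comp_hasFDerivAt x h1
  have h4 := ((hF.contDiffAt_hessGrad hx (hs x hx)).differentiableAt one_ne_zero).hasFDerivAt
  have h5 : HasFDerivAt (cutoffMap F s E a) _ x := (h2.smul h4).add ((h3.const_mul a).smul_const E)
  have h6 : fderiv ℝ F x = fderiv ℝ F (radialProj F x) := by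
    conv_lhs => rw [← hF.smul_radialProj hx, hF.fderiv_smul hr]
  have h7 : fderiv ℝ (hessGrad F s) x = (F x)⁻¹ • fderiv ℝ (hessGrad F s) (radialProj F x) := by
    conv_lhs => rw [← hF.smul_radialProj hx, hF.fderiv_hessGrad_smul hs1 hr]
  rw [h5.fderiv, h6, h7]
  ext1 v
  simp only [add_apply, smul_apply, ContinuousLinearMap.smulRight_apply, smul_eq_mul]
  module

/-- The integral of the Jacobian density over the space, in radial form, vanishes. -/
theorem integral_radial_det_eq_zero {S : Space n → ℝ} (hS : ∀ x ∈ wulff F, S x = s x)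
    {φ : Space n → (Fin n → ℝ) → Space n} (hφ : ∀ z ∈ wulff F, IsOrthonormalCoords F z (φ z)) :
    Integrable (fun x => radialWeight n (F x) * (fderiv ℝ F (radialProj F x) E *
      (uMatrix F (φ (radialProj F x)) S).det)) ∧
    ∫ x, radialWeight n (F x) * (fderiv ℝ F (radialProj F x) E *
      (uMatrix F (φ (radialProj F x)) S).det) = 0 := by
  have hint : ∀ a, Integrable fun x => (fderiv ℝ (cutoffMap F s E a) x).det := by
    intro a
    have hc := contDiff_cutoffMap hF hs E a
    have hcs := (hasCompactSupport_cutoffMap hF (s := s) E a).fderiv ℝ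
    refine Continuous.integrable_of_hasCompactSupport
      (ContinuousLinearMap.continuous_det.comp (hc.continuous_fderiv one_ne_zero)) ?_
    refine hcs.comp_left (g := ContinuousLinearMap.det) ?_
    change LinearMap.det (0 : Space n →ₗ[ℝ] Space n) = 0
    rw [LinearMap.det_zero]
    simp
  have hzero : ∀ a, ∫ x, (fderiv ℝ (cutoffMap F s E a) x).det = 0 := fun a =>
    integral_det_fderiv_eq_zero volume (contDiff_cutoffMap hF hs E a)
      (hasCompactSupport_cutoffMap hF E a)
  -- The determinant is affine in a, so this difference isolates the E term and discards the
  -- contribution of η' X.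
  have hae : (fun x => (fderiv ℝ (cutoffMap F s E 0) x).det - (fderiv ℝ (cutoffMap F s E 1) x).det)
      =ᵐ[volume] fun x => radialWeight n (F x) * (fderiv ℝ F (radialProj F x) E *
      (uMatrix F (φ (radialProj F x)) S).det) := by
    have h0 : ∀ᵐ x : Space n, x ≠ 0 := by
      simp [ae_iff]
    filter_upwards [h0] with x hx
    have hdet := (hφ _ (hF.radialProj_mem hx)).det_fderiv_hessGrad hF hs hs1 hS
    rw [fderiv_cutoffMap hF hs E 0 hs1 hx, fderiv_cutoffMap hF hs E 1 hs1 hx, hdet, hdet,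
      ← neg_eq_iff_eq_neg.2 (deriv_mul_annulusCutoff_pow n (F x))]
    simp only [map_add, map_smul, smul_eq_mul]
    ring
  refine ⟨((hint 0).sub (hint 1)).congr hae, ?_⟩
  rw [← integral_congr_ae hae, integral_sub (hint 0) (hint 1), hzero, hzero, sub_zero]

end cutoffMap

end AnisoMinkowski

/-! ### Measure comparison and scaling -/

theorem LipschitzOnWith.euclideanHausdorffMeasure_image_le {X Y : Type*} [MetricSpace X]
    [MeasurableSpace X] [BorelSpace X] [MetricSpace Y] [MeasurableSpace Y] [BorelSpace Y]
    {K : NNReal} {f : X → Y} {s : Set X} (h : LipschitzOnWith K f s) (d : ℕ) :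
    Measure.euclideanHausdorffMeasure d (f '' s)
      ≤ (K : ENNReal) ^ d * Measure.euclideanHausdorffMeasure d s := by
  rw [Measure.euclideanHausdorffMeasure_def, Measure.euclideanHausdorffMeasure_def,
    Measure.smul_apply, Measure.smul_apply, ENNReal.smul_def, ENNReal.smul_def, smul_eq_mul,
    smul_eq_mul, mul_left_comm]
  gcongr
  simpa using h.hausdorffMeasure_image_le (d := d) (by positivity)

theorem lintegral_comp_smul {E : Type*} [NormedAddCommGroup E] [NormedSpace ℝ E]
    [FiniteDimensional ℝ E] [MeasurableSpace E] [BorelSpace E] (μ : Measure E) [μ.IsAddHaarMeasure]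
    {r : ℝ} (hr : 0 < r) {f : E → ENNReal} (hf : Measurable f) :
    ∫⁻ x, f x ∂μ = ENNReal.ofReal (r ^ Module.finrank ℝ E) * ∫⁻ x, f (r • x) ∂μ := by
  have h := Measure.map_addHaar_smul μ hr.ne'
  have h2 : ∫⁻ x, f (r • x) ∂μ = ∫⁻ x, f x ∂(Measure.map (r • ·) μ) :=
    (lintegral_map hf (measurable_const_smul r)).symm
  have hp : 0 < r ^ Module.finrank ℝ E := pow_pos hr _
  rw [h2, h, lintegral_smul_measure, smul_eq_mul, ← mul_assoc, ← ENNReal.ofReal_mul hp.le,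
    abs_of_pos (inv_pos.2 hp), mul_inv_cancel₀ hp.ne', ENNReal.ofReal_one, one_mul]

/-- A local inequality between two measures is a global one. -/
theorem measure_le_mul_of_locally {X : Type*} [TopologicalSpace X] [SecondCountableTopology X]
    [MeasurableSpace X] [OpensMeasurableSpace X] {μ ν : Measure X} {W : Set X} {c : ENNReal}
    (h : ∀ z ∈ W, ∃ U ∈ 𝓝 z, ∀ A ⊆ U ∩ W, MeasurableSet A → μ A ≤ c * ν A)
    {A : Set X} (hAW : A ⊆ W) (hA : MeasurableSet A) : μ A ≤ c * ν A := by
  choose! U hU hUA using h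
  obtain ⟨t, htW, htc, ht⟩ := TopologicalSpace.countable_cover_nhdsWithin
    (s := W) (f := fun z => interior (U z)) fun z hz =>
      mem_nhdsWithin_of_mem_nhds (interior_mem_nhds.2 (hU z hz))
  rcases A.eq_empty_or_nonempty with rfl | ⟨a, ha⟩
  · simp
  have htne : t.Nonempty := by
    obtain ⟨i, hi, _⟩ := mem_iUnion₂.1 (ht (hAW ha))
    exact ⟨i, hi⟩
  obtain ⟨f, rfl⟩ := htc.exists_eq_range htne
  set D : ℕ → Set X := fun i => A ∩ disjointed (fun i => interior (U (f i))) i with hD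
  have hDm : ∀ i, MeasurableSet (D i) := fun i =>
    hA.inter (MeasurableSet.disjointed (fun i => isOpen_interior.measurableSet) i)
  have hDd : Pairwise (Function.onFun Disjoint D) := fun i j hij =>
    (disjoint_disjointed _ hij).mono inter_subset_right inter_subset_right
  have hAD : A = ⋃ i, D i := by
    rw [← inter_iUnion, iUnion_disjointed, eq_comm, inter_eq_left]
    intro x hx
    obtain ⟨i, ⟨k, rfl⟩, hi⟩ := mem_iUnion₂.1 (ht (hAW hx))
    exact mem_iUnion.2 ⟨k, hi⟩
  rw [hAD, measure_iUnion hDd hDm, measure_iUnion hDd hDm, ← ENNReal.tsum_mul_left]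
  refine ENNReal.tsum_le_tsum fun i => hUA (f i) (htW ⟨i, rfl⟩) _ ?_ (hDm i)
  rintro x ⟨hxA, hx⟩
  exact ⟨interior_subset (disjointed_subset _ i hx), hAW hxA⟩

/-! ### Integration in cones over a hyperplane, and the dual norm of the normal -/

namespace AnisoMinkowski

variable {n : ℕ} {F : Space n → ℝ}

/-- The hyperplane orthogonal to a nonzero vector as an isometric copy of Euclidean space. -/
theorem exists_isometry_hyperplane {g : Space n} (hg : g ≠ 0) :
    ∃ L : EuclideanSpace ℝ (Fin n) →ₗᵢ[ℝ] Space n, (∀ u, inner ℝ g (L u) = 0) ∧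
      ∀ v, inner ℝ g v = 0 → ∃ u, L u = v := by
  have : Fact (Module.finrank ℝ (Space n) = n + 1) := ⟨by simp⟩
  let e := (OrthonormalBasis.fromOrthogonalSpanSingleton (𝕜 := ℝ) n hg).repr.symm
  refine ⟨(Submodule.subtypeₗᵢ _).comp e.toLinearIsometry, fun u => ?_, fun v hv => ?_⟩
  · exact Submodule.mem_orthogonal_singleton_iff_inner_right.1 (e u).2
  · refine ⟨e.symm ⟨v, Submodule.mem_orthogonal_singleton_iff_inner_right.2 hv⟩, ?_⟩
    simp

section hyperplane

variable {g : Space n} (hg : g ≠ 0) {L : EuclideanSpace ℝ (Fin n) →ₗᵢ[ℝ] Space n}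
  (hL : ∀ u, inner ℝ g (L u) = 0)
include hg hL

/-- Fubini's theorem along the foliation by hyperplanes orthogonal to `g`. -/
theorem lintegral_eq_lintegral_lintegral_hyperplane {f : Space n → ENNReal} (hf : Measurable f) :
    ∫⁻ x, f x = ENNReal.ofReal ‖g‖⁻¹ *
      ∫⁻ s : ℝ, ∫⁻ v, f (s • ((‖g‖ ^ 2)⁻¹ • g) + L v) := by
  have hgn : 0 < ‖g‖ := norm_pos_iff.2 hg
  let I0 : WithLp 2 (ℝ × EuclideanSpace ℝ (Fin n)) →ₗ[ℝ] Space n :=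
    { toFun := fun q => q.fst • (‖g‖⁻¹ • g) + L q.snd
      map_add' := fun a b => by simp [add_smul]; abel
      map_smul' := fun c a => by simp [mul_smul] }
  let I1 : WithLp 2 (ℝ × EuclideanSpace ℝ (Fin n)) →ₗᵢ[ℝ] Space n :=
    ⟨I0, fun q => by
      have h1 : ‖I0 q‖ ^ 2 = ‖q‖ ^ 2 := by
        change ‖q.fst • (‖g‖⁻¹ • g) + L q.snd‖ ^ 2 = _
        rw [norm_add_sq_real, inner_smul_left, inner_smul_left, hL, WithLp.prod_norm_sq_eq_of_L2,
          norm_smul, norm_smul, norm_inv, norm_norm, inv_mul_cancel₀ hgn.ne', L.norm_map]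
        simp
      exact (sq_eq_sq₀ (norm_nonneg _) (norm_nonneg _)).1 h1⟩
  have hfr : Module.finrank ℝ (WithLp 2 (ℝ × EuclideanSpace ℝ (Fin n)))
      = Module.finrank ℝ (Space n) := by
    rw [(WithLp.linearEquiv 2 ℝ (ℝ × EuclideanSpace ℝ (Fin n))).finrank_eq,
      Module.finrank_prod, Module.finrank_self, finrank_euclideanSpace_fin,
      finrank_euclideanSpace_fin, add_comm]
  have hmp := (I1.toLinearIsometryEquiv hfr).measurePreserving.comp
    (WithLp.volume_preserving_toLp ℝ (EuclideanSpace ℝ (Fin n)))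
  have h1 : ∫⁻ x, f x = ∫⁻ q : ℝ × EuclideanSpace ℝ (Fin n), f (q.1 • (‖g‖⁻¹ • g) + L q.2) :=
    (hmp.lintegral_comp hf).symm
  have hm : Measurable fun q : ℝ × EuclideanSpace ℝ (Fin n) => f (q.1 • (‖g‖⁻¹ • g) + L q.2) :=
    hf.comp hmp.measurable
  -- Rescaling the normal coordinate by ‖g‖⁻¹ makes it equal to ⟨g, x⟩ and produces the prefactor.
  rw [h1, Measure.volume_eq_prod, lintegral_prod _ hm.aemeasurable,
    lintegral_comp_smul volume (inv_pos.2 hgn) hm.lintegral_prod_right', Module.finrank_self,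
    pow_one]
  congr 1
  refine lintegral_congr fun s => lintegral_congr fun v => ?_
  rw [smul_eq_mul, smul_smul, smul_smul]
  congr 3
  field_simp

/-- Integration over an open half space in cones over a hyperplane. -/
theorem lintegral_eq_lintegral_cone {f : Space n → ENNReal} (hf : Measurable f)
    (hf0 : ∀ x, inner ℝ g x ≤ 0 → f x = 0) :
    ∫⁻ x, f x = ENNReal.ofReal ‖g‖⁻¹ * ∫⁻ u, ∫⁻ s in Ioi (0 : ℝ),
      ENNReal.ofReal (s ^ n) * f (s • ((‖g‖ ^ 2)⁻¹ • g + L u)) := by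
  have hgn : 0 < ‖g‖ := norm_pos_iff.2 hg
  have hLm : Measurable L := L.continuous.measurable
  rw [lintegral_eq_lintegral_lintegral_hyperplane hg hL hf]
  congr 1
  have h1 : ∀ s : ℝ, ∫⁻ v, f (s • ((‖g‖ ^ 2)⁻¹ • g) + L v)
      = (Ioi (0 : ℝ)).indicator (fun s => ∫⁻ u, ENNReal.ofReal (s ^ n) *
        f (s • ((‖g‖ ^ 2)⁻¹ • g + L u))) s := by
    intro s
    by_cases hs : 0 < s
    -- The slice ⟨g, x⟩ = s is rescaled by v = s u, with Jacobian sⁿ; slices with s ≤ 0 carry no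
    -- mass.
    · rw [indicator_of_mem (show s ∈ Ioi (0 : ℝ) from hs), lintegral_comp_smul volume hs
        (by fun_prop), finrank_euclideanSpace_fin, ← lintegral_const_mul _ (by fun_prop)]
      simp [smul_add]
    · rw [indicator_of_notMem (show s ∉ Ioi (0 : ℝ) from hs)]
      refine (lintegral_congr fun v => ?_).trans lintegral_zero
      apply hf0
      rw [inner_add_right, hL, inner_smul_right, inner_smul_right, real_inner_self_eq_norm_sq,
        inv_mul_cancel₀ (pow_pos hgn 2).ne']
      linarith
  simp_rw [h1]
  rw [lintegral_indicator measurableSet_Ioi]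
  exact lintegral_lintegral_swap (by fun_prop)

end hyperplane

theorem inner_gradient (z v : Space n) : inner ℝ (gradient F z) v = fderiv ℝ F z v := by
  rw [gradient, InnerProductSpace.toDual_symm_apply]

namespace IsMinkowskiNorm

variable (hF : IsMinkowskiNorm F)
include hF

/-- A convex function lies above its tangent at z, and F(z) = dF(z)z makes that tangent linear.
Equality at x = z then gives the supremum in `dualNorm_outerNormal`. -/
theorem fderiv_le {z : Space n} (hz : z ∈ wulff F) (x : Space n) : fderiv ℝ F z x ≤ F x := by
  have hc : ConvexOn ℝ univ (F ∘ AffineMap.lineMap (k := ℝ) z x) := by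
    simpa using hF.convex.comp_affineMap (AffineMap.lineMap (k := ℝ) z x)
  have hd : HasDerivAt (F ∘ AffineMap.lineMap (k := ℝ) z x) (fderiv ℝ F z (x - z)) 0 := by
    have h1 := ((hF.contDiffAt (hF.ne_zero hz)).differentiableAt (by simp)).hasFDerivAt
    have h2 : HasDerivAt (AffineMap.lineMap (k := ℝ) z x) (x - z) (0 : ℝ) :=
      AffineMap.hasDerivAt_lineMap
    refine HasFDerivAt.comp_hasDerivAt (0 : ℝ) ?_ h2
    simpa using h1
  have h := hc.le_slope_of_hasDerivAt (mem_univ 0) (mem_univ 1) one_pos hd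
  rw [slope_def_field] at h
  simp only [Function.comp_apply, AffineMap.lineMap_apply_one, AffineMap.lineMap_apply_zero,
    map_sub, hF.fderiv_self hz, show F z = 1 from hz, sub_zero, div_one] at h
  linarith

theorem gradient_ne_zero {z : Space n} (hz : z ∈ wulff F) : gradient F z ≠ 0 := by
  intro h
  have h2 := inner_gradient (F := F) z z
  rw [h, inner_zero_left, hF.fderiv_self hz] at h2
  exact zero_ne_one h2

theorem dualNorm_outerNormal {z : Space n} (hz : z ∈ wulff F) :
    dualNorm F (outerNormal F z) = ‖gradient F z‖⁻¹ := by
  have hval : ∀ x : {x : Space n // x ≠ 0}, inner ℝ (x : Space n) (outerNormal F z) / F x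
      = ‖gradient F z‖⁻¹ * (fderiv ℝ F z x / F x) := by
    intro x
    rw [outerNormal, inner_smul_right, real_inner_comm, inner_gradient, mul_div_assoc]
  have hle : ∀ x : {x : Space n // x ≠ 0}, inner ℝ (x : Space n) (outerNormal F z) / F x
      ≤ ‖gradient F z‖⁻¹ := by
    intro x
    rw [hval]
    refine mul_le_of_le_one_right (by positivity) ?_
    rw [div_le_one (hF.pos _ x.2)]
    exact hF.fderiv_le hz x
  have : Nonempty {x : Space n // x ≠ 0} := ⟨⟨z, hF.ne_zero hz⟩⟩
  refine le_antisymm (ciSup_le hle)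
    (le_ciSup_of_le ⟨_, forall_mem_range.2 hle⟩ ⟨z, hF.ne_zero hz⟩ ?_)
  rw [hval, hF.fderiv_self hz, show F z = 1 from hz, div_one, mul_one]

theorem continuousAt_gradient {x : Space n} (hx : x ≠ 0) : ContinuousAt (gradient F) x :=
  (InnerProductSpace.toDual ℝ (Space n)).symm.continuous.continuousAt.comp
    ((hF.contDiffAt hx).fderiv_right (m := 0) (by simp)).continuousAt

end IsMinkowskiNorm

/-! ### The cone measure in the tangent hyperplane chart -/

/-- The cone measure of the Wulff shape: a radial measure of the ambient space, projected to
the Wulff shape. -/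
noncomputable def coneMeasure (F : Space n → ℝ) : Measure (Space n) :=
  (volume.withDensity fun x => ENNReal.ofReal (radialWeight n (F x))).map (radialProj F)

/-- The point over `u` of the affine hyperplane tangent to the Wulff shape, in direction `g`. -/
noncomputable def tangentPoint (g : Space n) (L : EuclideanSpace ℝ (Fin n) →ₗᵢ[ℝ] Space n)
    (u : EuclideanSpace ℝ (Fin n)) : Space n := (‖g‖ ^ 2)⁻¹ • g + L u

/-- The central projection of the tangent hyperplane to the Wulff shape. -/
noncomputable def tangentChart (F : Space n → ℝ) (g : Space n)
    (L : EuclideanSpace ℝ (Fin n) →ₗᵢ[ℝ] Space n) (u : EuclideanSpace ℝ (Fin n)) : Space n :=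
  radialProj F (tangentPoint g L u)

/-- The inverse of the chart given by the tangent hyperplane. -/
noncomputable def tangentCoord (g : Space n) (L : EuclideanSpace ℝ (Fin n) →ₗᵢ[ℝ] Space n)
    (a : Space n) : EuclideanSpace ℝ (Fin n) :=
  (inner ℝ g a)⁻¹ • L.toContinuousLinearMap.adjoint a

section chart

variable (hF : IsMinkowskiNorm F) {g : Space n} (hg : g ≠ 0)
  {L : EuclideanSpace ℝ (Fin n) →ₗᵢ[ℝ] Space n} (hL : ∀ u, inner ℝ g (L u) = 0)

include hg hL in
theorem inner_tangentPoint (u : EuclideanSpace ℝ (Fin n)) :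
    inner ℝ g (tangentPoint g L u) = 1 := by
  rw [tangentPoint, inner_add_right, hL, inner_smul_right, real_inner_self_eq_norm_sq, add_zero,
    inv_mul_cancel₀ (pow_ne_zero 2 (norm_ne_zero_iff.2 hg))]

include hg hL in
theorem tangentPoint_ne_zero (u : EuclideanSpace ℝ (Fin n)) : tangentPoint g L u ≠ 0 := by
  intro h
  have := inner_tangentPoint hg hL u
  rw [h, inner_zero_right] at this
  exact zero_ne_one this

theorem continuous_tangentPoint : Continuous (tangentPoint g L) :=
  continuous_const.add L.continuous

include hL in
theorem adjoint_tangentPoint (u : EuclideanSpace ℝ (Fin n)) :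
    L.toContinuousLinearMap.adjoint (tangentPoint g L u) = u := by
  refine ext_inner_right ℝ fun w => ?_
  rw [ContinuousLinearMap.adjoint_inner_left, tangentPoint]
  change inner ℝ _ (L w) = _
  rw [inner_add_left, inner_smul_left, hL, mul_zero, zero_add, L.inner_map_map]

include hF in
theorem measurable_tangentChart : Measurable (tangentChart F g L) :=
  hF.measurable_radialProj.comp continuous_tangentPoint.measurable

include hF hg hL in
theorem tangentCoord_tangentChart (u : EuclideanSpace ℝ (Fin n)) :
    tangentCoord g L (tangentChart F g L u) = u := by
  have hp := hF.pos _ (tangentPoint_ne_zero hg hL u)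
  rw [tangentCoord, tangentChart, radialProj, inner_smul_right, inner_tangentPoint hg hL, map_smul,
    adjoint_tangentPoint hL, smul_smul, mul_one, inv_inv, mul_inv_cancel₀ hp.ne', one_smul]

include hg hL in
theorem tangentPoint_tangentCoord (hL' : ∀ v, inner ℝ g v = 0 → ∃ u, L u = v) {a : Space n}
    (ha : inner ℝ g a ≠ 0) :
    tangentPoint g L (tangentCoord g L a) = (inner ℝ g a)⁻¹ • a := by
  obtain ⟨u, hu⟩ := hL' ((inner ℝ g a)⁻¹ • a - (‖g‖ ^ 2)⁻¹ • g) (by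
    rw [inner_sub_right, inner_smul_right, inner_smul_right, real_inner_self_eq_norm_sq,
      inv_mul_cancel₀ ha, inv_mul_cancel₀ (pow_ne_zero 2 (norm_ne_zero_iff.2 hg)), sub_self])
  have h1 : (inner ℝ g a)⁻¹ • a = tangentPoint g L u := by
    rw [tangentPoint, hu, add_sub_cancel]
  have h2 : tangentCoord g L a = u := by
    rw [tangentCoord, ← map_smul, h1, adjoint_tangentPoint hL]
  rw [h1, h2]

include hF hg hL in
theorem tangentChart_tangentCoord (hL' : ∀ v, inner ℝ g v = 0 → ∃ u, L u = v) {a : Space n}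
    (haW : a ∈ wulff F) (ha : 0 < inner ℝ g a) :
    tangentChart F g L (tangentCoord g L a) = a := by
  rw [tangentChart, tangentPoint_tangentCoord hg hL hL' ha.ne', hF.radialProj_smul (inv_pos.2 ha),
    IsMinkowskiNorm.radialProj_of_mem haW]

/-- Substitute t = s r in the normalized integral of `lintegral_radialWeight`. This evaluates the
integral along the ray through a hyperplane point where F = r. -/
theorem lintegral_radialWeight_smul {r : ℝ} (hr : 0 < r) :
    ∫⁻ s in Ioi (0 : ℝ), ENNReal.ofReal (s ^ n) * ENNReal.ofReal (radialWeight n (s * r))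
      = ENNReal.ofReal (r⁻¹ ^ (n + 1)) := by
  have hm : Measurable fun t : ℝ => ENNReal.ofReal (t ^ n * radialWeight n t) :=
    ((measurable_id.pow_const n).mul (measurable_radialWeight n)).ennreal_ofReal
  have h1 := lintegral_radialWeight n
  rw [← lintegral_indicator measurableSet_Ioi,
    lintegral_comp_smul volume hr (hm.indicator measurableSet_Ioi), Module.finrank_self,
    pow_one] at h1
  have h2 : ∀ s : ℝ, (Ioi (0 : ℝ)).indicator
      (fun t : ℝ => ENNReal.ofReal (t ^ n * radialWeight n t)) (r • s)
      = ENNReal.ofReal (r ^ n) * (Ioi (0 : ℝ)).indicator (fun s => ENNReal.ofReal (s ^ n) *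
        ENNReal.ofReal (radialWeight n (s * r))) s := by
    intro s
    by_cases hs : 0 < s
    · rw [indicator_of_mem (show r • s ∈ Ioi (0 : ℝ) from mul_pos hr hs),
        indicator_of_mem (show s ∈ Ioi (0 : ℝ) from hs), ← ENNReal.ofReal_mul (by positivity),
        ← ENNReal.ofReal_mul (by positivity), smul_eq_mul, mul_pow, mul_comm r s, mul_assoc]
    · rw [indicator_of_notMem (show r • s ∉ Ioi (0 : ℝ) from fun h =>
          hs ((mul_pos_iff_of_pos_left hr).1 h)),
        indicator_of_notMem (show s ∉ Ioi (0 : ℝ) from hs), mul_zero]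
  simp_rw [h2] at h1
  rw [lintegral_const_mul _ (Measurable.indicator (by
      exact (measurable_id.pow_const n).ennreal_ofReal.mul
        ((measurable_radialWeight n).comp (measurable_id.mul_const r)).ennreal_ofReal)
      measurableSet_Ioi),
    lintegral_indicator measurableSet_Ioi, ← mul_assoc, ← ENNReal.ofReal_mul hr.le, ← pow_succ'] at h1
  rw [inv_pow, ENNReal.ofReal_inv_of_pos (pow_pos hr _)]
  exact ENNReal.eq_inv_of_mul_eq_one_left ((mul_comm _ _).trans h1)

include hF hg hL in
theorem coneMeasure_apply {A : Set (Space n)} (hA : MeasurableSet A)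
    (hAg : ∀ a ∈ A, 0 < inner ℝ g a) :
    coneMeasure F A = ENNReal.ofReal ‖g‖⁻¹ * ∫⁻ u in tangentChart F g L ⁻¹' A,
      ENNReal.ofReal ((F (tangentPoint g L u))⁻¹ ^ (n + 1)) := by
  have hπ := hF.measurable_radialProj
  have hw : Measurable fun x => ENNReal.ofReal (radialWeight n (F x)) :=
    ((measurable_radialWeight n).comp hF.continuous.measurable).ennreal_ofReal
  rw [coneMeasure, Measure.map_apply hπ hA, withDensity_apply _ (hπ hA),
    ← lintegral_indicator (hπ hA),
    lintegral_eq_lintegral_cone hg hL (hw.indicator (hπ hA)),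
    ← lintegral_indicator (measurable_tangentChart hF hA)]
  · congr 1
    refine lintegral_congr fun u => ?_
    have hp := hF.pos _ (tangentPoint_ne_zero hg hL u)
    by_cases hu : tangentChart F g L u ∈ A
    · rw [indicator_of_mem (show u ∈ tangentChart F g L ⁻¹' A from hu),
        ← lintegral_radialWeight_smul hp]
      refine setLIntegral_congr_fun measurableSet_Ioi fun s hs => ?_
      change _ * (radialProj F ⁻¹' A).indicator _ (s • tangentPoint g L u) = _
      rw [indicator_of_mem (by rw [mem_preimage, hF.radialProj_smul hs]; exact hu),
        hF.homogeneous s hs]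
    · rw [indicator_of_notMem (show u ∉ tangentChart F g L ⁻¹' A from hu)]
      refine (setLIntegral_congr_fun measurableSet_Ioi fun s hs => ?_).trans lintegral_zero
      change _ * (radialProj F ⁻¹' A).indicator _ (s • tangentPoint g L u) = _
      rw [indicator_of_notMem (by rw [mem_preimage, hF.radialProj_smul hs]; exact hu), mul_zero]
  · intro x hx
    refine indicator_of_notMem (fun h => ?_) _
    have h1 := hAg _ h
    rw [radialProj, inner_smul_right] at h1
    exact absurd h1 (not_lt.2 (mul_nonpos_of_nonneg_of_nonpos (inv_nonneg.2 (hF.nonneg x)) hx))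

end chart

namespace IsMinkowskiNorm

variable (hF : IsMinkowskiNorm F) {z : Space n} (hz : z ∈ wulff F)
  {L : EuclideanSpace ℝ (Fin n) →ₗᵢ[ℝ] Space n} (hL : ∀ u, inner ℝ (gradient F z) (L u) = 0)
include hF hz

theorem inner_gradient_self : inner ℝ (gradient F z) z = 1 := by
  rw [inner_gradient, hF.fderiv_self hz]

include hL

theorem tangentPoint_tangentCoord_self (hL' : ∀ v, inner ℝ (gradient F z) v = 0 → ∃ u, L u = v) :
    tangentPoint (gradient F z) L (tangentCoord (gradient F z) L z) = z := by
  rw [tangentPoint_tangentCoord (hF.gradient_ne_zero hz) hL hL'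
    (by rw [hF.inner_gradient_self hz]; exact one_ne_zero), hF.inner_gradient_self hz, inv_one,
    one_smul]

/-- The chart given by the tangent hyperplane is isometric to first order at the centre. -/
theorem hasStrictFDerivAt_tangentChart
    (hL' : ∀ v, inner ℝ (gradient F z) v = 0 → ∃ u, L u = v) :
    HasStrictFDerivAt (tangentChart F (gradient F z) L) L.toContinuousLinearMap
      (tangentCoord (gradient F z) L z) := by
  set u₀ := tangentCoord (gradient F z) L z
  have hu : tangentPoint (gradient F z) L u₀ = z := hF.tangentPoint_tangentCoord_self hz hL hL'
  have h0 := hF.ne_zero hz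
  have hz1 : F z = 1 := hz
  have h1 : HasStrictFDerivAt (tangentPoint (gradient F z) L) L.toContinuousLinearMap u₀ :=
    L.toContinuousLinearMap.hasStrictFDerivAt.const_add _
  have h2 : HasStrictFDerivAt F (fderiv ℝ F z) (tangentPoint (gradient F z) L u₀) := by
    rw [hu]; exact (hF.contDiffAt h0).hasStrictFDerivAt (by simp)
  have h3 := (hasStrictDerivAt_inv (show F (tangentPoint (gradient F z) L u₀) ≠ 0 by
    rw [hu, hz1]; exact one_ne_zero)).comp_hasStrictFDerivAt u₀ (h2.comp u₀ h1)
  have h4 : HasStrictFDerivAt (tangentChart F (gradient F z) L) _ u₀ := h3.smul h1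
  refine h4.congr_fderiv ?_
  ext1 v
  -- The derivative of 1/F contributes nothing, since L takes values in the kernel of dF(z).
  have h5 : fderiv ℝ F z (L v) = 0 := by rw [← inner_gradient, hL]
  simp [hu, hz1, h5]

end IsMinkowskiNorm

end AnisoMinkowski

/-! ### The cone measure equals the anisotropic measure -/

/-- A map that is strictly differentiable with isometric derivative is almost isometric near the
point. -/
theorem HasStrictFDerivAt.exists_nhds_almost_isometry {E E' : Type*} [NormedAddCommGroup E]
    [NormedSpace ℝ E] [NormedAddCommGroup E'] [NormedSpace ℝ E'] {f : E → E'} {L : E →ₗᵢ[ℝ] E'}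
    {a : E} (hf : HasStrictFDerivAt f L.toContinuousLinearMap a) {k : NNReal} (hk : 1 < k) :
    ∃ N ∈ 𝓝 a, ∀ x ∈ N, ∀ y ∈ N, dist (f x) (f y) ≤ k * dist x y ∧
      dist x y ≤ k * dist (f x) (f y) := by
  have hk' : (1 : ℝ) < k := hk
  have hk0 : (0 : ℝ) < k := by linarith
  have hkinv : (k : ℝ) * (k : ℝ)⁻¹ = 1 := mul_inv_cancel₀ hk0.ne'
  have hc : (0 : ℝ) < 1 - (k : ℝ)⁻¹ := by
    have := inv_lt_one_of_one_lt₀ hk'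
    linarith
  -- With error 1 - 1/k the lower bound is exactly 1/k, and the upper bound 2 - 1/k is at most k.
  obtain ⟨N, hN, happ⟩ := hf.approximates_deriv_on_nhds
    (c := ⟨1 - (k : ℝ)⁻¹, hc.le⟩) (Or.inr hc)
  refine ⟨N, hN, fun x hx y hy => ?_⟩
  have h1 : ‖f x - f y - L (x - y)‖ ≤ (1 - (k : ℝ)⁻¹) * ‖x - y‖ := happ x hx y hy
  have h2 : ‖f x - f y‖ ≤ ‖f x - f y - L (x - y)‖ + ‖L (x - y)‖ := by
    simpa using norm_add_le (f x - f y - L (x - y)) (L (x - y))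
  have h3 : ‖L (x - y)‖ ≤ ‖f x - f y‖ + ‖f x - f y - L (x - y)‖ := by
    simpa using norm_sub_le (f x - f y) (f x - f y - L (x - y))
  rw [L.norm_map] at h2 h3
  rw [dist_eq_norm, dist_eq_norm]
  have hn := norm_nonneg (x - y)
  constructor
  · have : 2 - (k : ℝ)⁻¹ ≤ k := by nlinarith [sq_nonneg ((k : ℝ) - 1)]
    nlinarith
  · have : (k : ℝ)⁻¹ * ‖x - y‖ ≤ ‖f x - f y‖ := by linarith
    calc ‖x - y‖ = k * ((k : ℝ)⁻¹ * ‖x - y‖) := by rw [← mul_assoc, hkinv, one_mul]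
      _ ≤ k * ‖f x - f y‖ := by gcongr

namespace AnisoMinkowski

variable {n : ℕ} {F : Space n → ℝ}

namespace IsMinkowskiNorm

variable (hF : IsMinkowskiNorm F)
include hF

theorem anisoMeasure_apply {A : Set (Space n)} (hA : MeasurableSet A) (hAW : A ⊆ wulff F) :
    anisoMeasure F A = ∫⁻ a in A, ENNReal.ofReal ‖gradient F a‖⁻¹
      ∂(Measure.euclideanHausdorffMeasure n) := by
  rw [anisoMeasure, withDensity_apply _ hA, Measure.restrict_restrict hA,
    inter_eq_self_of_subset_left hAW]
  exact setLIntegral_congr_fun hA fun a ha => by rw [hF.dualNorm_outerNormal (hAW ha)]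

/-- Near each point of the Wulff shape the cone measure and the anisotropic measure agree up to
a factor close to one. -/
theorem exists_nhds_coneMeasure_compare {z : Space n} (hz : z ∈ wulff F) {k : NNReal}
    (hk : 1 < k) :
    ∃ U ∈ 𝓝 z, ∀ A ⊆ U ∩ wulff F, MeasurableSet A →
      coneMeasure F A ≤ (k : ENNReal) ^ (2 * n + 2) * anisoMeasure F A ∧
      anisoMeasure F A ≤ (k : ENNReal) ^ (2 * n + 2) * coneMeasure F A := by
  have hk' : (1 : ℝ) < k := hk
  have hk0 : (0 : ℝ) ≤ k := k.2
  set g := gradient F z with hgdef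
  have hg : g ≠ 0 := hF.gradient_ne_zero hz
  have hgn : 0 < ‖g‖⁻¹ := inv_pos.2 (norm_pos_iff.2 hg)
  have hgz : inner ℝ g z = 1 := hF.inner_gradient_self hz
  obtain ⟨L, hL, hL'⟩ := exists_isometry_hyperplane hg
  set u₀ := tangentCoord g L z with hu₀
  have hu₀z : tangentPoint g L u₀ = z := hF.tangentPoint_tangentCoord_self hz hL hL'
  obtain ⟨N, hN, hiso⟩ :=
    (hF.hasStrictFDerivAt_tangentChart hz hL hL').exists_nhds_almost_isometry hk
  have hFc : ContinuousAt (fun u => (F (tangentPoint g L u))⁻¹) u₀ :=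
    ((hF.continuous.comp continuous_tangentPoint).continuousAt).inv₀
      (hF.pos _ (tangentPoint_ne_zero hg hL u₀)).ne'
  have hF1 : (F (tangentPoint g L u₀))⁻¹ = 1 := by rw [hu₀z, show F z = 1 from hz, inv_one]
  have hN1 : ∀ᶠ u in 𝓝 u₀, (F (tangentPoint g L u))⁻¹ < k :=
    hFc.eventually (gt_mem_nhds (by beta_reduce; rw [hF1]; exact hk'))
  have hN2 : ∀ᶠ u in 𝓝 u₀, (k : ℝ)⁻¹ < (F (tangentPoint g L u))⁻¹ :=
    hFc.eventually (lt_mem_nhds (by beta_reduce; rw [hF1]; exact inv_lt_one_of_one_lt₀ hk'))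
  have hinner : Continuous fun a : Space n => inner ℝ g a := by fun_prop
  have hcoord : ContinuousAt (tangentCoord g L) z :=
    (hinner.continuousAt.inv₀ (by rw [hgz]; exact one_ne_zero)).smul
      (L.toContinuousLinearMap.adjoint).continuous.continuousAt
  have hgrad : ContinuousAt (fun a => ‖gradient F a‖⁻¹) z :=
    (hF.continuousAt_gradient (hF.ne_zero hz)).norm.inv₀ (norm_ne_zero_iff.2 hg)
  have hU1 : ∀ᶠ a in 𝓝 z, 0 < inner ℝ g a :=
    hinner.continuousAt.eventually (lt_mem_nhds (by beta_reduce; rw [hgz]; exact one_pos))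
  have hU2 : ∀ᶠ a in 𝓝 z, ‖gradient F a‖⁻¹ < k * ‖g‖⁻¹ :=
    hgrad.eventually (gt_mem_nhds (by beta_reduce; rw [← hgdef]; nlinarith))
  have hU3 : ∀ᶠ a in 𝓝 z, (k : ℝ)⁻¹ * ‖g‖⁻¹ < ‖gradient F a‖⁻¹ :=
    hgrad.eventually (lt_mem_nhds (by
      beta_reduce; rw [← hgdef]; nlinarith [inv_lt_one_of_one_lt₀ hk']))
  have hU4 := hcoord.eventually (Filter.inter_mem hN (Filter.inter_mem hN1 hN2))
  refine ⟨_, (hU1.and (hU2.and (hU3.and hU4))), fun A hAU hA => ?_⟩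
  have hAW : A ⊆ wulff F := fun a ha => (hAU ha).2
  set B := tangentChart F g L ⁻¹' A with hB
  have hBm : MeasurableSet B := measurable_tangentChart hF hA
  have hinv : ∀ a ∈ A, tangentChart F g L (tangentCoord g L a) = a := fun a ha =>
    tangentChart_tangentCoord hF hg hL hL' (hAW ha) (hAU ha).1.1
  have hcB : ∀ u ∈ B, u ∈ N ∧ (F (tangentPoint g L u))⁻¹ < k ∧
      (k : ℝ)⁻¹ < (F (tangentPoint g L u))⁻¹ := by
    intro u hu
    have := (hAU hu).1.2.2.2
    rw [tangentCoord_tangentChart hF hg hL] at this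
    exact this
  have himg : tangentChart F g L '' B = A := by
    apply Subset.antisymm (image_preimage_subset _ _)
    exact fun a ha => ⟨_, by rw [mem_preimage, hinv a ha]; exact ha, hinv a ha⟩
  have himg' : tangentCoord g L '' A = B := by
    rw [← himg, image_image]
    simp [tangentCoord_tangentChart hF hg hL]
  have hH1 : Measure.euclideanHausdorffMeasure n A ≤ (k : ENNReal) ^ n * volume B := by
    have h : LipschitzOnWith k (tangentChart F g L) B := LipschitzOnWith.of_dist_le_mul
      fun u hu v hv => (hiso u (hcB u hu).1 v (hcB v hv).1).1
    have := h.euclideanHausdorffMeasure_image_le n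
    rwa [himg, EuclideanSpace.euclideanHausdorffMeasure_eq_volume] at this
  have hH2 : volume B ≤ (k : ENNReal) ^ n * Measure.euclideanHausdorffMeasure n A := by
    have h : LipschitzOnWith k (tangentCoord g L) A := LipschitzOnWith.of_dist_le_mul
      fun a ha b hb => by
        have h1 : ∀ a ∈ A, tangentCoord g L a ∈ N := fun a ha => (hAU ha).1.2.2.2.1
        have := (hiso _ (h1 a ha) _ (h1 b hb)).2
        rwa [hinv a ha, hinv b hb] at this
    have := h.euclideanHausdorffMeasure_image_le n
    rwa [himg', EuclideanSpace.euclideanHausdorffMeasure_eq_volume] at this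
  have hkR : ENNReal.ofReal k = k := ENNReal.ofReal_coe_nnreal
  have hkinv : (k : ℝ) * (k : ℝ)⁻¹ = 1 := mul_inv_cancel₀ (by linarith)
  set κ := ENNReal.ofReal ‖g‖⁻¹ with hκ
  have hcone := coneMeasure_apply hF hg hL hA fun a ha => (hAU ha).1.1
  have hC1 : coneMeasure F A ≤ κ * ((k : ENNReal) ^ (n + 1) * volume B) := by
    rw [hcone, ← setLIntegral_const]
    refine mul_le_mul_right ?_ _
    refine setLIntegral_mono' hBm fun u hu => ?_
    rw [← hkR, ← ENNReal.ofReal_pow hk0]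
    refine ENNReal.ofReal_le_ofReal (pow_le_pow_left₀ ?_ (hcB u hu).2.1.le _)
    exact inv_nonneg.2 (hF.nonneg _)
  have hC2 : κ * volume B ≤ (k : ENNReal) ^ (n + 1) * coneMeasure F A := by
    rw [hcone, mul_left_comm, ← lintegral_const_mul' _ _ (by finiteness)]
    gcongr
    rw [← setLIntegral_one]
    refine setLIntegral_mono' hBm fun u hu => ?_
    rw [← hkR, ← ENNReal.ofReal_pow hk0, ← ENNReal.ofReal_mul (by positivity), ← mul_pow,
      ENNReal.one_le_ofReal]
    refine one_le_pow₀ ?_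
    rw [← hkinv]
    exact mul_le_mul_of_nonneg_left (hcB u hu).2.2.le hk0
  have hA1 : anisoMeasure F A ≤ k * κ * Measure.euclideanHausdorffMeasure n A := by
    rw [hF.anisoMeasure_apply hA hAW, ← setLIntegral_const]
    refine setLIntegral_mono' hA fun a ha => ?_
    rw [← hkR, hκ, ← ENNReal.ofReal_mul hk0]
    exact ENNReal.ofReal_le_ofReal (hAU ha).1.2.1.le
  have hA2 : κ * Measure.euclideanHausdorffMeasure n A ≤ k * anisoMeasure F A := by
    rw [hF.anisoMeasure_apply hA hAW, ← lintegral_const_mul' _ _ (by finiteness),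
      ← setLIntegral_const]
    refine setLIntegral_mono' hA fun a ha => ?_
    rw [← hkR, hκ, ← ENNReal.ofReal_mul hk0]
    refine ENNReal.ofReal_le_ofReal ?_
    have := mul_le_mul_of_nonneg_left (hAU ha).1.2.2.1.le hk0
    rwa [← mul_assoc, hkinv, one_mul] at this
  -- The exponent 2n + 2 collects n from the Lipschitz bound on Hausdorff measure, n + 1 from the
  -- power of F, and 1 from the density 1/|∇F|.
  constructor
  · calc coneMeasure F A ≤ κ * ((k : ENNReal) ^ (n + 1) * volume B) := hC1
      _ ≤ κ * ((k : ENNReal) ^ (n + 1) *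
          ((k : ENNReal) ^ n * Measure.euclideanHausdorffMeasure n A)) := by gcongr
      _ = (k : ENNReal) ^ (2 * n + 1) * (κ * Measure.euclideanHausdorffMeasure n A) := by ring
      _ ≤ (k : ENNReal) ^ (2 * n + 1) * (k * anisoMeasure F A) := by gcongr
      _ = (k : ENNReal) ^ (2 * n + 2) * anisoMeasure F A := by ring
  · calc anisoMeasure F A ≤ k * κ * Measure.euclideanHausdorffMeasure n A := hA1
      _ ≤ k * κ * ((k : ENNReal) ^ n * volume B) := by gcongr
      _ = (k : ENNReal) ^ (n + 1) * (κ * volume B) := by ring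
      _ ≤ (k : ENNReal) ^ (n + 1) * ((k : ENNReal) ^ (n + 1) * coneMeasure F A) := by gcongr
      _ = (k : ENNReal) ^ (2 * n + 2) * coneMeasure F A := by ring

omit hF in
theorem le_of_forall_le_pow_mul {a b : ENNReal} (m : ℕ)
    (h : ∀ k : NNReal, 1 < k → a ≤ (k : ENNReal) ^ m * b) : a ≤ b := by
  rcases eq_or_ne b ⊤ with rfl | hb
  · exact le_top
  have h1 : Tendsto (fun k : NNReal => (k : ENNReal) ^ m * b) (𝓝[>] 1) (𝓝 (1 * b)) := by
    refine ENNReal.Tendsto.mul_const ?_ (Or.inr hb)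
    have : Continuous fun k : NNReal => (k : ENNReal) ^ m := by fun_prop
    have h2 := this.tendsto 1
    rw [ENNReal.coe_one, one_pow] at h2
    exact h2.mono_left nhdsWithin_le_nhds
  rw [one_mul] at h1
  exact ge_of_tendsto h1 (by filter_upwards [self_mem_nhdsWithin] with k hk using h k hk)

theorem coneMeasure_compl_wulff : coneMeasure F (wulff F)ᶜ = 0 := by
  have hm := hF.measurableSet_wulff.compl
  rw [coneMeasure, Measure.map_apply hF.measurable_radialProj hm]
  refine withDensity_absolutelyContinuous _ _ (measure_mono_null (t := {0}) ?_ (by simp))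
  intro x hx
  by_contra h0
  exact hx (hF.radialProj_mem h0)

omit hF in
theorem anisoMeasure_compl_wulff (hm : MeasurableSet (wulff F)) :
    anisoMeasure F (wulff F)ᶜ = 0 := by
  refine withDensity_absolutelyContinuous _ _ ?_
  rw [Measure.restrict_apply hm.compl, compl_inter_self, measure_empty]

/-- The cone measure is the anisotropic measure. -/
theorem coneMeasure_eq : coneMeasure F = anisoMeasure F := by
  have hW := hF.measurableSet_wulff
  have key : ∀ A ⊆ wulff F, MeasurableSet A → coneMeasure F A = anisoMeasure F A := by
    intro A hAW hA
    refine le_antisymm (le_of_forall_le_pow_mul (2 * n + 2) fun k hk => ?_)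
      (le_of_forall_le_pow_mul (2 * n + 2) fun k hk => ?_)
    · refine measure_le_mul_of_locally (fun z hz => ?_) hAW hA
      obtain ⟨U, hU, h⟩ := hF.exists_nhds_coneMeasure_compare hz hk
      exact ⟨U, hU, fun A hA hAm => (h A hA hAm).1⟩
    · refine measure_le_mul_of_locally (fun z hz => ?_) hAW hA
      obtain ⟨U, hU, h⟩ := hF.exists_nhds_coneMeasure_compare hz hk
      exact ⟨U, hU, fun A hA hAm => (h A hA hAm).2⟩
  ext A hA
  have h1 : coneMeasure F (A \ wulff F) = 0 :=
    measure_mono_null (fun x hx => hx.2) hF.coneMeasure_compl_wulff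
  have h2 : anisoMeasure F (A \ wulff F) = 0 :=
    measure_mono_null (fun x hx => hx.2) (anisoMeasure_compl_wulff hW)
  rw [← measure_inter_add_sdiff A hW, ← measure_inter_add_sdiff (μ := anisoMeasure F) A hW,
    key _ inter_subset_right (hA.inter hW), h1, h2]

end IsMinkowskiNorm

end AnisoMinkowski

/-! ### Conclusion -/

theorem corollary5p3 (n : ℕ) (F : AnisoMinkowski.Space n → ℝ)
    (hF : AnisoMinkowski.IsMinkowskiNorm F)
    (S : AnisoMinkowski.Space n → ℝ)
    (hS : AnisoMinkowski.IsC2OnHypersurface (AnisoMinkowski.wulff F) S)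
    (φ : AnisoMinkowski.Space n → (Fin n → ℝ) → AnisoMinkowski.Space n)
    (hφ : ∀ z ∈ AnisoMinkowski.wulff F, AnisoMinkowski.IsOrthonormalCoords F z (φ z))
    (α : Fin (n + 1)) :
    MeasureTheory.Integrable
      (fun z => AnisoMinkowski.metricG F z z (EuclideanSpace.single α 1) *
        (AnisoMinkowski.uMatrix F (φ z) S).det) (AnisoMinkowski.anisoMeasure F) ∧
    ∫ z, AnisoMinkowski.metricG F z z (EuclideanSpace.single α 1) *
        (AnisoMinkowski.uMatrix F (φ z) S).det ∂(AnisoMinkowski.anisoMeasure F) = 0 := by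
  open AnisoMinkowski in
  set E : Space n := EuclideanSpace.single α 1
  set s := homExt F S
  have hs : ∀ x, x ≠ 0 → ContDiffAt ℝ 2 s x := hF.contDiffAt_homExt hS
  have hs1 : ∀ r : ℝ, 0 < r → ∀ x, s (r • x) = r * s x := hF.homExt_smul S
  have hSs : ∀ x ∈ wulff F, S x = s x := fun x hx => IsMinkowskiNorm.homExt_of_mem S hx
  obtain ⟨hint, hzero⟩ := integral_radial_det_eq_zero hF hs E hs1 hSs hφ
  -- The coordinates `φ z` are chosen pointwise with no regularity in z. This function is visibly
  -- measurable and agrees with the integrand on the Wulff shape, by the determinant formula with a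
  -- = 1.
  let h : Space n → ℝ := fun z => (fderiv ℝ (hessGrad F s) z + (fderiv ℝ F z).smulRight E).det
  have hh : ∀ z ∈ wulff F, h z = fderiv ℝ F z E * (uMatrix F (φ z) S).det := by
    intro z hz
    have := (hφ z hz).det_fderiv_hessGrad hF hs hs1 hSs 1 E
    rwa [one_smul, one_pow, one_mul] at this
  have hhm : Measurable h := by
    refine ContinuousLinearMap.continuous_det.measurable.comp ?_
    have h1 : Measurable fun z => (fderiv ℝ F z).smulRight E :=
      (((ContinuousLinearMap.smulRightL ℝ (Space n) (Space n)).flip E).continuous.measurable).comp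
        (measurable_fderiv ℝ F)
    exact (measurable_fderiv ℝ _).add h1
  have hae : h =ᵐ[anisoMeasure F] fun z => metricG F z z E * (uMatrix F (φ z) S).det := by
    have hW : ∀ᵐ z ∂(anisoMeasure F), z ∈ wulff F :=
      IsMinkowskiNorm.anisoMeasure_compl_wulff hF.measurableSet_wulff
    filter_upwards [hW] with z hz
    rw [hh z hz, metricG_eq, hF.hess_self_of_mem hz]
  have hae0 : (fun x => radialWeight n (F x) * (fderiv ℝ F (radialProj F x) E *
      (uMatrix F (φ (radialProj F x)) S).det))
      =ᵐ[MeasureTheory.volume] fun x => radialWeight n (F x) * h (radialProj F x) := by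
    have h0 : ∀ᵐ x : Space n, x ≠ 0 := by simp [MeasureTheory.ae_iff]
    filter_upwards [h0] with x hx
    rw [hh _ (hF.radialProj_mem hx)]
  have hwm : Measurable fun x => ENNReal.ofReal (radialWeight n (F x)) :=
    ((measurable_radialWeight n).comp hF.continuous.measurable).ennreal_ofReal
  have hto : ∀ x, (ENNReal.ofReal (radialWeight n (F x))).toReal = radialWeight n (F x) :=
    fun x => ENNReal.toReal_ofReal (radialWeight_nonneg n (hF.nonneg x))
  have hlt : ∀ᵐ x ∂(MeasureTheory.volume : MeasureTheory.Measure (Space n)),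
      ENNReal.ofReal (radialWeight n (F x)) < ⊤ :=
    MeasureTheory.ae_of_all _ fun x => ENNReal.ofReal_lt_top
  rw [← MeasureTheory.integrable_congr hae, ← MeasureTheory.integral_congr_ae hae,
    ← hF.coneMeasure_eq, coneMeasure]
  constructor
  · rw [MeasureTheory.integrable_map_measure hhm.aestronglyMeasurable
      hF.measurable_radialProj.aemeasurable,
      MeasureTheory.integrable_withDensity_iff_integrable_smul' hwm hlt]
    simp only [hto, smul_eq_mul, Function.comp_apply]
    exact hint.congr hae0
  · rw [MeasureTheory.integral_map hF.measurable_radialProj.aemeasurable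
      hhm.aestronglyMeasurable,
      integral_withDensity_eq_integral_toReal_smul hwm hlt]
    simp only [hto, smul_eq_mul]
    rw [← MeasureTheory.integral_congr_ae hae0, hzero]
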